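/- Let $(X,\mu)$ be a standard Borel probability space and $\mathcal R\subset X\times X$ a Borel equivalence relation with countable classes $[x]$ such that $\mu$ is $\mathcal R$-invariant: with $c$ the counting measure, $\mu\times c$ and $c\times\mu$ agree on $\mathcal R$ (a discrete p.m.p. equivalence relation). Let $\mathbb I$ be either $\{1,2,3,\dots\}$ or $\mathbb R_{>0}$, and let $\mathcal F=\{\mathcal F_r\}_{r\in\mathbb I}$ be a Borel family of subset functions: $\mathcal F_r(x)\subset[x]$, the set $\{(x,y,r): y\in\mathcal F_r(x)\}$ is Borel, and $\bigcup_{s\le r}\mathcal F_s(x)$ is finite for all $x\in X$, $r\in\mathbb I$. For maps $U,V$ from $X$ to subsets of $X$ put $U^{-1}(y)=\{x: y\in U(x)\}$ and $UV(x)=\bigcup_{y\in V(x)}U(y)$. The family $\mathcal F$ is called - *regular* if there is $C_{reg}>0$ such that for a.e. $x$ and all $r\in\mathbb I$, $\big|\bigcup_{t\le r}\mathcal F_t^{-1}\mathcal F_r(x)\big|\le C_{reg}|\mathcal F_r(x)|$; - *tempered* if $\mathbb I=\{1,2,\dots\}$ and there is $C_t$ such that for a.e. $x$ and all $n$, $\big|\bigcup_{m\le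 n-1}\mathcal F_m^{-1}\mathcal F_n(x)\big|\le C_t|\mathcal F_n(x)|$; - *uniform* if there are constants $C_u,a_r,b_r>0$ with $b_r\le C_u a_r$ and $a_r\le|\mathcal F_r(x)|\le b_r$, $a_r\le|\mathcal F_r^{-1}(x)|\le b_r$ for every $r\in\mathbb I$ and a.e. $x$; - *asymptotically invariant* if for a.e. $x$ one has $|\mathcal F_r(x)|\ge1$ for all $r$, and there is a countable set $\Psi$ of Borel automorphisms of $X$ with graphs in $\mathcal R$ that generates $\mathcal R$ (for a.e. $x$ and every $y\in[x]$ there is $\psi\in\langle\Psi\rangle$ with $\psi(x)=y$) such that for every $\psi\in\Psi$ and a.e. $x$, $|\mathcal F_r(x)\,\triangle\,\psi(\mathcal F_r(x))|/|\mathcal F_r(x)|\to0$ as $r\to\infty$. A *class-bijective extension* of $(X,\mu,\mathcal R)$ is a discrete p.m.p. equivalence relation $(\tilde X,\tilde\mu,\tilde{\mathcal R})$ (on a standard Borel probability space) with a Borel map $\pi:\tilde X\to X$ such that $\pi_*\tilde\mu=\mu$, $(x,x')\in\tilde{\mathcal R}$ implies $(\pi(x),\pi(x'))\in\mathcal R$,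 and for a.e. $x\in\tilde X$ the map $\pi$ restricts to a bijection from $[x]$ onto $[\pi(x)]$. The lifted family is $\tilde{\mathcal F}_r(x)=\pi^{-1}(\mathcal F_r(\pi(x)))\cap[x]$, and for a real- or complex-valued function $f$ on $\tilde X$, $$\mathbb M[f|\tilde{\mathcal F}](x)=\sup_{r\in\mathbb I}\frac1{|\tilde{\mathcal F}_r(x)|}\sum_{x'\in\tilde{\mathcal F}_r(x)}|f(x')|\in[0,\infty]$$ (an average over the empty set is $0$). Let $\|f\|_{L\log L}=\inf\{c>0:\int\frac{|f|}{c}\log^+\frac{|f|}{c}\,d\tilde\mu\le1\}$, and let $L\log L$ be the space of measurable functions for which this is finite. Suppose that $\mathcal F$ is either regular, or asymptotically invariant, uniform and tempered. Then: 1. For every $p\in(1,\infty]$ there is a constant $C_p>0$ such that for every class-bijective extension $(\tilde X,\tilde\mu,\tilde{\mathcal R})$ and every $f\in L^p(\tilde X,\tilde\mu)$, the function $\mathbb M[f|\tilde{\mathcal F}]$ is $\tilde\mu$-measurable and $\|\mathbb M[f|\tilde{\mathcal F}]\|_p\le C_p\|f\|_p$. 2. There is a constant $C_1>0$ such that for every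 class-bijective extension $(\tilde X,\tilde\mu,\tilde{\mathcal R})$ and every $f\in (L\log L)(\tilde X,\tilde\mu)$, the function $\mathbb M[f|\tilde{\mathcal F}]$ is $\tilde\mu$-measurable and $\|\mathbb M[f|\tilde{\mathcal F}]\|_1\le C_1\|f\|_{L\log L}$. -/

import Mathlib

open MeasureTheory Filter Topology Set
open scoped ENNReal NNReal

universe u v w

namespace AmenableRel

/-- Cardinality of a set, as an element of `[0, ∞]`. -/
noncomputable def card {X : Type u} (s : Set X) : ℝ≥0∞ := (s.encard : ℝ≥0∞)

/-- The equivalence class `[x]`. -/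
def cls {X : Type u} (R : Setoid X) (x : X) : Set X := {y | R x y}

/-- `μ` is `R`-invariant: the measures `μ × c` and `c × μ` (`c` = counting measure) agree on all
Borel subsets `E` of `R`, i.e. `∫ #{y : (x, y) ∈ E} dμ(x) = ∫ #{x : (x, y) ∈ E} dμ(y)`. -/
def IsInvariant {X : Type u} [MeasurableSpace X] (R : Setoid X) (μ : Measure X) : Prop :=
  ∀ E : Set (X × X), MeasurableSet E → (∀ q ∈ E, R q.1 q.2) →
    ∫⁻ x, card {y | (x, y) ∈ E} ∂μ = ∫⁻ y, card {x | (x, y) ∈ E} ∂μ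

/-- `(X, μ, R)` is a discrete measure-preserving equivalence relation.  (That `X` is a standard
Borel space and that `μ` is a probability measure are kept as type class hypotheses.) -/
structure IsDiscreteMP {X : Type u} [MeasurableSpace X] (R : Setoid X) (μ : Measure X) :
    Prop where
  measurableSet : MeasurableSet {q : X × X | R q.1 q.2}
  countable : ∀ x, (cls R x).Countable
  invariant : IsInvariant R μ

/-- The inner automorphisms of `R` (the full group): Borel automorphisms with graph in `R`. -/
def Inn {X : Type u} [MeasurableSpace X] (R : Setoid X) : Set (Equiv.Perm X) :=
  {ψ | Measurable ψ ∧ Measurable ψ.symm ∧ ∀ x, R x (ψ x)}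

/-- `Ψ` generates `R` with respect to `μ`: for a.e. `x`, every `y ∈ [x]` is of the form `ψ x`
with `ψ` in the group generated by `Ψ`. -/
def Generates {X : Type u} [MeasurableSpace X] (R : Setoid X) (μ : Measure X)
    (Ψ : Set (Equiv.Perm X)) : Prop :=
  ∀ᵐ x ∂μ, ∀ y, R x y → ∃ ψ ∈ Subgroup.closure Ψ, ψ x = y

/-- The positive integers, as a subset of `ℝ`. -/
def posInts : Set ℝ := range fun n : ℕ+ => ((n : ℕ) : ℝ)

/-- A Borel family of subset functions for `R`, indexed by `I ⊆ ℝ` (which will be either the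
positive integers or the positive reals), with the standing assumption that
`⋃_{s ≤ r} F_s(x)` is finite for all `x` and `r`. -/
structure IsBorelFamily {X : Type u} [MeasurableSpace X] (R : Setoid X) {I : Set ℝ}
    (F : I → X → Set X) : Prop where
  subset_cls : ∀ r x, F r x ⊆ cls R x
  measurableSet : MeasurableSet {q : X × X × I | q.2.1 ∈ F q.2.2 q.1}
  finite : ∀ r x, (⋃ s ≤ r, F s x).Finite

/-- The inverse of a subset function. -/
def inv {X : Type u} (U : X → Set X) : X → Set X := fun y => {x | y ∈ U x}

/-- The product of two subset functions. -/
def mul {X : Type u} (U V : X → Set X) : X → Set X := fun x => ⋃ y ∈ V x, U y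

def AsymptoticallyInvariant {X : Type u} [MeasurableSpace X] (R : Setoid X) (μ : Measure X)
    {I : Set ℝ} (F : I → X → Set X) : Prop :=
  (∀ᵐ x ∂μ, ∀ r, 1 ≤ card (F r x)) ∧
  ∃ Ψ : Set (Equiv.Perm X), Ψ.Countable ∧ Ψ ⊆ Inn R ∧ Generates R μ Ψ ∧
    ∀ ψ ∈ Ψ, ∀ᵐ x ∂μ,
      Tendsto (fun r => card (symmDiff (F r x) (ψ '' F r x)) / card (F r x)) atTop (𝓝 0)

def Uniform {X : Type u} [MeasurableSpace X] (μ : Measure X)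
    {I : Set ℝ} (F : I → X → Set X) : Prop :=
  ∃ (C : ℝ≥0) (a b : I → ℝ≥0), 0 < C ∧ ∀ r, 0 < a r ∧ 0 < b r ∧ b r ≤ C * a r ∧
    (∀ᵐ x ∂μ, (a r : ℝ≥0∞) ≤ card (F r x) ∧ card (F r x) ≤ b r) ∧
    (∀ᵐ x ∂μ, (a r : ℝ≥0∞) ≤ card (inv (F r) x) ∧ card (inv (F r) x) ≤ b r)

def Regular {X : Type u} [MeasurableSpace X] (μ : Measure X)
    {I : Set ℝ} (F : I → X → Set X) : Prop :=
  ∃ C : ℝ≥0, 0 < C ∧ ∀ᵐ x ∂μ, ∀ r, card (⋃ t ≤ r, mul (inv (F t)) (F r) x) ≤ C * card (F r x)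

/-- Temperedness is defined only for families indexed by the positive integers; there
`m ≤ n - 1` is the same as `m < n`. -/
def Tempered {X : Type u} [MeasurableSpace X] (μ : Measure X)
    {I : Set ℝ} (F : I → X → Set X) : Prop :=
  I = posInts ∧
  ∃ C : ℝ≥0, ∀ᵐ x ∂μ, ∀ n, card (⋃ m < n, mul (inv (F m)) (F n) x) ≤ C * card (F n x)

/-- `π : (Y, ν, S) → (X, μ, R)` is a class-bijective (p.m.p.) extension. -/
structure IsClassBijectiveExtension {X : Type u} [MeasurableSpace X] {Y : Type v}
    [MeasurableSpace Y] (π : Y → X) (S : Setoid Y) (ν : Measure Y) (R : Setoid X)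
    (μ : Measure X) : Prop where
  discreteMP : IsDiscreteMP S ν
  measurePreserving : MeasurePreserving π ν μ
  map_rel : ∀ y y', S y y' → R (π y) (π y')
  bijOn : ∀ᵐ y ∂ν, BijOn π (cls S y) (cls R (π y))

/-- The lift of a family of subset functions to an extension. -/
def lift {X : Type u} {Y : Type v} (π : Y → X) (S : Setoid Y) {I : Set ℝ}
    (F : I → X → Set X) : I → Y → Set Y :=
  fun r y => π ⁻¹' F r (π y) ∩ cls S y

/-- The average of `|f|` over `U x`, with values in `[0, ∞]` (it is `0` if `U x` is empty). -/
noncomputable def absAvg {Y : Type v} {𝕜 : Type*} [RCLike 𝕜] (f : Y → 𝕜) (U : Y → Set Y)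
    (y : Y) : ℝ≥0∞ :=
  (∑' z : U y, ‖f z‖ₑ) / card (U y)

/-- The maximal function of `f`, with values in `[0, ∞]`: the supremum over `r` of the
averages of `|f|` over `F r`. -/
noncomputable def maximal {Y : Type v} {𝕜 : Type*} [RCLike 𝕜] {I : Set ℝ}
    (F : I → Y → Set Y) (f : Y → 𝕜) (y : Y) : ℝ≥0∞ :=
  ⨆ r, absAvg f (F r) y

/-- The `L log L` norm: the Luxemburg norm of the Young function `t ↦ t log⁺ t`, that is
`inf {c > 0 : ∫ (|f|/c) log⁺ (|f|/c) dν ≤ 1}`. -/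
noncomputable def llogNorm {Y : Type v} [MeasurableSpace Y] {𝕜 : Type*} [RCLike 𝕜]
    (f : Y → 𝕜) (ν : Measure Y) : ℝ≥0∞ :=
  ⨅ (c : ℝ≥0) (_ : 0 < c)
    (_ : ∫⁻ y, ENNReal.ofReal (‖f y‖ / c * Real.posLog (‖f y‖ / c)) ∂ν ≤ 1), (c : ℝ≥0∞)

/-- Membership in `L log L`, as the Orlicz space of `t ↦ t log⁺ t`. -/
def MemLlog {Y : Type v} [MeasurableSpace Y] {𝕜 : Type*} [RCLike 𝕜]
    (f : Y → 𝕜) (ν : Measure Y) : Prop :=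
  AEStronglyMeasurable f ν ∧ llogNorm f ν < ∞

end AmenableRel

namespace AmenableRel

/-! Everything rests on a weak type (1,1) inequality `t * ν {M f > t} ≤ K * ∫ f`, with `K`
determined by the constants of `F` alone and hence common to all extensions
(`exists_weakType_lift`).

It is a covering argument in which the mass transport principle replaces double counting. On `D`,
select measurably an index `r x` for which the average of `f` over `U x = F_{r x}(x)` exceeds `t`.
Treat larger indices first, and keep `x` unless the weights `w y` of the points kept earlier with `z
∈ U y` add up to more than 1 at some `z ∈ U x`. The kept set `A` then has load at most 2 a.e., so `J
= ∫_A w |U|` satisfies `t J ≤ 2 ∫ f`. Each discarded `x` charges more than 1 to earlier kept points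
`y` with `U y` meeting `U x`; regularity or temperedness allows at most `b |U y|` such `x` per `y`,
so `ν (D \ A) ≤ b J`, while `ν A ≤ a J` (`IsDiscreteMP.covering`). Regular families use `w = 1`,
with ties broken so that intersecting sets have distinct ranks. Uniform tempered families use `w = 1
/ b_r` and treat all points of one index at once.

The index set may be uncountable, so superlevel sets of the maximal function are only projections of
Borel sets. Choquet's capacitability theorem makes them universally measurable and provides the
selection.

Finally, truncating `f` at height `t` turns the weak inequality into `t * ν {M f > 2t} ≤ K * ∫_{f >
t} f`, and layer-cake integration yields the `L^p` and `L log L` bounds. For `p = ∞` averaging is a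
contraction. -/

/-! ### Capacitability, analytic sets and measurable selection -/

/-- An open set containing a box `{α | ∀ i, α i ≤ N i}` of Baire space contains all sequences
satisfying finitely many of the inequalities. -/
theorem exists_initial_box_subset (N : ℕ → ℕ) {V : Set (ℕ → ℕ)} (hV : IsOpen V)
    (hN : {α | ∀ i, α i ≤ N i} ⊆ V) : ∃ k, {α : ℕ → ℕ | ∀ i < k, α i ≤ N i} ⊆ V := by
  have hK : IsCompact {α : ℕ → ℕ | ∀ i, α i ≤ N i} := by
    have := isCompact_univ_pi (fun i => (Set.finite_Iic (N i)).isCompact)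
    convert this using 1
    ext α; simp [Pi.le_def]
  have h1 : ∀ x ∈ {α : ℕ → ℕ | ∀ i, α i ≤ N i}, ∃ n, PiNat.cylinder x n ⊆ V := by
    intro x hx
    obtain ⟨u, ⟨y, n, rfl⟩, hxu, hu⟩ :=
      (PiNat.isTopologicalBasis_cylinders (E := fun _ => ℕ)).exists_subset_of_mem_open (hN hx) hV
    exact ⟨n, by rwa [PiNat.mem_cylinder_iff_eq.1 hxu]⟩
  choose! n hn using h1
  obtain ⟨t, ht, htc⟩ := hK.elim_nhds_subcover (fun x => PiNat.cylinder x (n x))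
    (fun x _ => (PiNat.isOpen_cylinder _ x (n x)).mem_nhds (PiNat.self_mem_cylinder x _))
  refine ⟨t.sup n, fun α hα => ?_⟩
  -- Cutting `α` down to the box does not change its first `t.sup n` coordinates, and these decide
  -- membership in the chosen cylinder.
  have hmin : (fun i => min (α i) (N i)) ∈ {α : ℕ → ℕ | ∀ i, α i ≤ N i} :=
    fun i => min_le_right _ _
  obtain ⟨x, hx, hxm⟩ := mem_iUnion₂.1 (htc hmin)
  refine hn x (ht x hx) fun i hi => ?_
  rw [← hxm i hi]
  exact (min_eq_left (hα i (hi.trans_le (Finset.le_sup hx)))).symm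

/-- **Choquet's capacitability theorem** for continuous images of Baire space. -/
theorem exists_isCompact_lt_measure_image {X : Type*} [TopologicalSpace X] [MeasurableSpace X]
    [OpensMeasurableSpace X] (ν : Measure X) [ν.OuterRegular] {f : (ℕ → ℕ) → X}
    (hf : Continuous f) {t : ℝ≥0∞} (ht : t < ν (range f)) :
    ∃ K : Set (ℕ → ℕ), IsCompact K ∧ t ≤ ν (f '' K) := by
  -- One coordinate at a time is bounded while the image keeps measure above `t`; continuity from
  -- below needs no measurability of the images.
  have step : ∀ (k : ℕ) (S : Set (ℕ → ℕ)), ∃ m : ℕ, t < ν (f '' S) →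
      t < ν (f '' (S ∩ {α | α k ≤ m})) := by
    intro k S
    by_cases h : t < ν (f '' S)
    swap
    · exact ⟨0, fun h' => absurd h' h⟩
    have hU : f '' S = ⋃ m, f '' (S ∩ {α | α k ≤ m}) := by
      rw [← image_iUnion, ← inter_iUnion]
      congr 1
      refine (inter_eq_left.2 fun α _ => mem_iUnion.2 ⟨α k, le_refl (α k)⟩).symm
    have hmono : Monotone fun m : ℕ => f '' (S ∩ {α | α k ≤ m}) := fun a b hab =>
      image_mono (inter_subset_inter_right _ fun α (hα : α k ≤ a) => hα.trans hab)
    rw [hU, hmono.measure_iUnion] at h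
    obtain ⟨m, hm⟩ := lt_iSup_iff.1 h
    exact ⟨m, fun _ => hm⟩
  choose m hm using step
  let S : ℕ → Set (ℕ → ℕ) := fun k => Nat.rec univ (fun k s => s ∩ {α | α k ≤ m k s}) k
  have hS : ∀ k, t < ν (f '' S k) := by
    intro k
    induction k with
    | zero => simpa [S] using ht
    | succ k ih => exact hm k (S k) ih
  have hSbox : ∀ k, S k = {α : ℕ → ℕ | ∀ i < k, α i ≤ m i (S i)} := by
    intro k
    induction k with
    | zero => simp [S]
    | succ k ih =>
      change S k ∩ {α | α k ≤ m k (S k)} = _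
      ext α
      constructor
      · rintro ⟨h1, h2⟩ i hi
        rcases Nat.lt_succ_iff_lt_or_eq.1 hi with h | rfl
        · exact (ih ▸ h1 : α ∈ {α : ℕ → ℕ | ∀ i < k, α i ≤ m i (S i)}) i h
        · exact h2
      · intro h
        refine ⟨?_, h k (Nat.lt_succ_self k)⟩
        rw [ih]
        exact fun i hi => h i (hi.trans (Nat.lt_succ_self k))
  refine ⟨{α | ∀ i, α i ≤ m i (S i)}, ?_, ?_⟩
  · have := isCompact_univ_pi (fun i => (Set.finite_Iic (m i (S i))).isCompact)
    convert this using 1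
    ext α; simp [Pi.le_def]
  -- By outer regularity it suffices to test open `U` containing the image: such a `U` already
  -- contains the image of a finite stage `S k`, which has measure above `t`.
  · rw [Set.measure_eq_iInf_isOpen]
    refine le_iInf₂ fun U hU => le_iInf fun hUo => ?_
    obtain ⟨k, hk⟩ := exists_initial_box_subset _ (hUo.preimage hf) (image_subset_iff.1 hU)
    rw [← hSbox] at hk
    exact (hS k).le.trans (measure_mono (image_subset_iff.2 hk))

theorem nullMeasurableSet_of_forall_lt {X : Type*} [MeasurableSpace X] (ν : Measure X)
    [IsFiniteMeasure ν] {A : Set X}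
    (h : ∀ t < ν A, ∃ B ⊆ A, MeasurableSet B ∧ t ≤ ν B) : NullMeasurableSet A ν := by
  rcases eq_or_ne (ν A) 0 with h0 | h0
  · exact NullMeasurableSet.of_null h0
  obtain ⟨u, -, hu, hlim⟩ := exists_seq_strictMono_tendsto' (pos_iff_ne_zero.2 h0)
  choose B hBA hB hBt using fun n => h (u n) (hu n).2
  have hsub : (⋃ n, B n) ⊆ A := iUnion_subset hBA
  have hle : ν A ≤ ν (⋃ n, B n) := le_of_tendsto hlim
    (Eventually.of_forall fun n => (hBt n).trans (measure_mono (subset_iUnion B n)))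
  have hmeas := MeasurableSet.iUnion hB
  exact (hmeas.nullMeasurableSet).congr
    (ae_eq_of_subset_of_measure_ge hsub hle hmeas.nullMeasurableSet (measure_ne_top _ _))

/-- Analytic sets are universally measurable. -/
theorem nullMeasurableSet_of_analyticSet {X : Type*} [TopologicalSpace X] [PolishSpace X]
    [MeasurableSpace X] [BorelSpace X] (ν : Measure X) [IsFiniteMeasure ν] {A : Set X}
    (hA : AnalyticSet A) : NullMeasurableSet A ν := by
  rw [AnalyticSet] at hA
  rcases hA with rfl | ⟨f, hf, rfl⟩
  · exact MeasurableSet.empty.nullMeasurableSet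
  let _ := TopologicalSpace.upgradeIsCompletelyMetrizable X
  refine nullMeasurableSet_of_forall_lt ν fun t ht => ?_
  obtain ⟨K, hK, hKt⟩ := exists_isCompact_lt_measure_image ν hf ht
  exact ⟨f '' K, image_subset_range _ _, (hK.image hf).measurableSet, hKt⟩

/-- The projection of a Borel set is universally measurable. -/
theorem nullMeasurableSet_image {X Z : Type*} [MeasurableSpace X] [StandardBorelSpace X]
    [MeasurableSpace Z] [StandardBorelSpace Z] (ν : Measure X) [IsFiniteMeasure ν]
    {f : Z → X} (hf : Measurable f) {P : Set Z} (hP : MeasurableSet P) :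
    NullMeasurableSet (f '' P) ν := by
  let _ := upgradeStandardBorel X
  exact nullMeasurableSet_of_analyticSet ν (hP.analyticSet_image hf)

/-- A measurable selection theorem, up to a set of small measure. -/
theorem exists_measurable_selection {X : Type*} [MeasurableSpace X] [StandardBorelSpace X]
    (ν : Measure X) [IsFiniteMeasure ν] {P : Set (X × ℝ)} (hP : MeasurableSet P)
    {t : ℝ≥0∞} (ht : t < ν (Prod.fst '' P)) :
    ∃ (D : Set X) (r : X → ℝ), MeasurableSet D ∧ Measurable r ∧ (∀ x ∈ D, (x, r x) ∈ P) ∧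
      t ≤ ν D := by
  let _ := upgradeStandardBorel X
  have hA := hP.analyticSet
  rw [AnalyticSet] at hA
  rcases hA with rfl | ⟨f, hf, hfP⟩
  · simp at ht
  let _ := TopologicalSpace.upgradeIsCompletelyMetrizable X
  have hcont : Continuous fun a => (f a).1 := continuous_fst.comp hf
  have hrange : Prod.fst '' P = range fun a => (f a).1 := by
    rw [← hfP, ← range_comp]; rfl
  rw [hrange] at ht
  obtain ⟨K, hK, hKt⟩ := exists_isCompact_lt_measure_image ν hcont ht
  have hL : IsCompact (f '' K) := hK.image hf
  have hLP : f '' K ⊆ P := hfP ▸ image_subset_range _ _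
  set L := f '' K
  have hDL : (fun a => (f a).1) '' K = Prod.fst '' L := by
    rw [← image_comp]; rfl
  rw [hDL] at hKt
  have hD : MeasurableSet (Prod.fst '' L) := (hL.image continuous_fst).measurableSet
  classical
  have hsec : ∀ x, IsCompact {s | (x, s) ∈ L} := fun x => by
    have : {s | (x, s) ∈ L} = Prod.snd '' (L ∩ Prod.fst ⁻¹' {x}) := by
      ext s
      constructor
      · exact fun h => ⟨(x, s), ⟨h, rfl⟩, rfl⟩
      · rintro ⟨⟨y, s'⟩, ⟨h1, h2⟩, rfl⟩
        have : y = x := h2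
        exact this ▸ h1
    rw [this]
    exact (hL.inter_right (isClosed_singleton.preimage continuous_fst)).image continuous_snd
  have hmax : ∀ x ∈ Prod.fst '' L, (x, sSup {s | (x, s) ∈ L}) ∈ L := by
    rintro x ⟨⟨y, s⟩, h, rfl⟩
    exact (hsec y).sSup_mem ⟨s, h⟩
  -- The selection is the largest point of the compact section. Its superlevel sets are projections
  -- of compact sets, up to the points off the projection, where the value is 0.
  refine ⟨Prod.fst '' L, fun x => if x ∈ Prod.fst '' L then sSup {s | (x, s) ∈ L} else 0,
    hD, ?_, fun x hx => ?_, hKt⟩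
  · refine measurable_of_Ici fun q => ?_
    have key : (fun x => if x ∈ Prod.fst '' L then sSup {s | (x, s) ∈ L} else 0) ⁻¹' Ici q
        = Prod.fst '' (L ∩ Prod.snd ⁻¹' Ici q) ∪ ((Prod.fst '' L)ᶜ ∩ {_x | q ≤ 0}) := by
      ext x
      by_cases hx : x ∈ Prod.fst '' L
      · simp only [mem_preimage, mem_Ici, mem_union, mem_inter_iff, mem_compl_iff,
          not_true_eq_false, false_and, or_false, hx]
        constructor
        · exact fun h => ⟨_, ⟨hmax x hx, h⟩, rfl⟩
        · rintro ⟨⟨y, s⟩, ⟨h1, h2⟩, rfl⟩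
          exact (show q ≤ s from h2).trans (le_csSup (hsec y).bddAbove h1)
      · have h' : x ∉ Prod.fst '' (L ∩ Prod.snd ⁻¹' Ici q) :=
          fun h => hx (image_mono inter_subset_left h)
        simp only [mem_preimage, mem_Ici, mem_union, h', false_or, mem_inter_iff,
          mem_compl_iff, hx, not_false_eq_true, true_and, ↓reduceIte, mem_ofPred_eq]
    rw [key]
    exact ((hL.inter_right (isClosed_Ici.preimage continuous_snd)).image
      continuous_fst).measurableSet.union (hD.compl.inter (MeasurableSet.const _))
  · simp only [if_pos hx]
    exact hLP (hmax x hx)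

/-! ### Counting the points of sections -/

theorem card_eq_tsum {Y : Type*} (s : Set Y) : card s = ∑' y, s.indicator 1 y := by
  rw [← tsum_subtype, card, ← ENNReal.tsum_set_one]
  rfl

theorem card_mono {Y : Type*} {s t : Set Y} (h : s ⊆ t) : card s ≤ card t := by
  rw [card, card]
  exact_mod_cast encard_le_encard h

theorem tsum_iSup_of_monotone {α : Type*} {f : ℕ → α → ℝ≥0∞} (hf : Monotone f) :
    ∑' a, ⨆ n, f n a = ⨆ n, ∑' a, f n a := by
  let _ : MeasurableSpace α := ⊤
  have : MeasurableSingletonClass α := ⟨fun _ => trivial⟩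
  simp only [← lintegral_count]
  exact lintegral_iSup (fun _ => measurable_from_top) hf

/-- The first `n` coordinates of the coding of a countably generated measurable space in the
Cantor space. -/
noncomputable def code (Y : Type*) [MeasurableSpace Y] [MeasurableSpace.CountablyGenerated Y]
    (n : ℕ) (y : Y) : Fin n → Bool :=
  fun i => MeasurableSpace.mapNatBool Y y i

section Code

variable {Y : Type*} [MeasurableSpace Y] [StandardBorelSpace Y]

theorem measurable_code (n : ℕ) : Measurable (code Y n) :=
  measurable_pi_lambda _ fun i =>
    (measurable_pi_apply (i : ℕ)).comp (MeasurableSpace.measurable_mapNatBool Y)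

theorem code_eq_of_le {m n : ℕ} (h : m ≤ n) {x y : Y} (hxy : code Y n x = code Y n y) :
    code Y m x = code Y m y :=
  funext fun i => congrFun hxy ⟨i, i.2.trans_le h⟩

theorem exists_code_ne {x y : Y} (h : x ≠ y) : ∃ n, code Y n x ≠ code Y n y := by
  by_contra! hc
  refine h (MeasurableSpace.injective_mapNatBool Y (funext fun i => ?_))
  exact congrFun (hc (i + 1)) ⟨i, Nat.lt_succ_self i⟩

theorem exists_injOn_code (s : Finset Y) : ∃ n, InjOn (code Y n) (s : Set Y) := by
  have : ∀ q : Y × Y, ∃ n, q.1 ≠ q.2 → code Y n q.1 ≠ code Y n q.2 := fun q => by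
    by_cases h : q.1 = q.2
    · exact ⟨0, fun h' => absurd h h'⟩
    · obtain ⟨n, hn⟩ := exists_code_ne h
      exact ⟨n, fun _ => hn⟩
  choose n hn using this
  refine ⟨(s ×ˢ s).sup n, fun x hx y hy hxy => ?_⟩
  by_contra hne
  exact hn (x, y) hne (code_eq_of_le
    (Finset.le_sup (f := n) (Finset.mk_mem_product (Finset.mem_coe.1 hx) (Finset.mem_coe.1 hy)))
    hxy)

/-- Long codes separate any given finite subset. Counting is thereby reduced to finitely many
existence questions at each stage, which is what makes cardinalities of sections measurable. -/
theorem card_eq_iSup_code (s : Set Y) : card s = ⨆ n, card (code Y n '' s) := by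
  refine le_antisymm ?_ (iSup_le fun n => ?_)
  · rw [card, ← ENNReal.tsum_set_one, ENNReal.tsum_eq_iSup_sum]
    refine iSup_le fun t => ?_
    classical
    obtain ⟨n, hn⟩ := exists_injOn_code (t.map (Function.Embedding.subtype s))
    refine le_trans ?_ (le_iSup _ n)
    have h1 : ((t.map (Function.Embedding.subtype s) : Finset Y) : Set Y) ⊆ s := by
      intro x hx
      simp only [Finset.coe_map, mem_image, Finset.mem_coe] at hx
      obtain ⟨y, -, rfl⟩ := hx
      exact y.2
    refine le_trans ?_ (card_mono (image_mono h1))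
    rw [card, hn.encard_image, encard_coe_eq_coe_finsetCard]
    simp
  · rw [card, card]
    exact_mod_cast encard_image_le _ _

variable {X : Type*} [MeasurableSpace X] [StandardBorelSpace X]
  {Z : Type*} [MeasurableSpace Z] [StandardBorelSpace Z]

theorem nullMeasurableSet_exists_exists (ν : Measure X) [IsFiniteMeasure ν]
    {P : Set (X × Y × Z)} (hP : MeasurableSet P) {T : Set Y} (hT : MeasurableSet T) :
    NullMeasurableSet {x | ∃ y ∈ T, ∃ z, (x, y, z) ∈ P} ν := by
  have h := nullMeasurableSet_image ν (measurable_fst (α := X) (β := Y × Z))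
    (hP.inter (hT.preimage (measurable_fst.comp measurable_snd)))
  convert h using 1
  ext x
  constructor
  · rintro ⟨y, hy, z, hz⟩
    exact ⟨(x, y, z), ⟨hz, hy⟩, rfl⟩
  · rintro ⟨⟨x, y, z⟩, ⟨h1, h2⟩, rfl⟩
    exact ⟨y, h2, z, h1⟩

/-- The cardinalities of the sections of an analytic set are universally measurable. -/
theorem aemeasurable_card_section (ν : Measure X) [IsFiniteMeasure ν]
    {P : Set (X × Y × Z)} (hP : MeasurableSet P) {T : Set Y} (hT : MeasurableSet T) :
    AEMeasurable (fun x => card {y | y ∈ T ∧ ∃ z, (x, y, z) ∈ P}) ν := by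
  rw [funext fun x => card_eq_iSup_code {y | y ∈ T ∧ ∃ z, (x, y, z) ∈ P}]
  refine AEMeasurable.iSup fun n => ?_
  simp only [card_eq_tsum, tsum_fintype]
  refine Finset.aemeasurable_fun_sum _ fun s _ => ?_
  have : (fun x => (code Y n '' {y | y ∈ T ∧ ∃ z, (x, y, z) ∈ P}).indicator
      (1 : (Fin n → Bool) → ℝ≥0∞) s) =
      {x | ∃ y ∈ T ∩ code Y n ⁻¹' {s}, ∃ z, (x, y, z) ∈ P}.indicator (fun _ => 1) := by
    ext x
    refine indicator_eq_indicator ?_ rfl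
    constructor
    · rintro ⟨y, ⟨h1, h2⟩, h3⟩
      exact ⟨y, ⟨h1, h3⟩, h2⟩
    · rintro ⟨y, ⟨h1, h3⟩, h2⟩
      exact ⟨y, ⟨h1, h2⟩, h3⟩
  rw [this]
  exact aemeasurable_const.indicator₀ (nullMeasurableSet_exists_exists ν hP
    (hT.inter (measurable_code n (measurableSet_singleton s))))

/-- Measurable uniformization over the points whose section in `T` is a singleton. -/
theorem exists_measurable_eq_of_section_singleton (ν : Measure Y) [IsFiniteMeasure ν]
    {P : Set (Y × Y × Z)} (hP : MeasurableSet P) {T : Set Y} (hT : MeasurableSet T) :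
    ∃ g : Y → Y, Measurable g ∧
      ∀ᵐ x ∂ν, ∀ y, {y | y ∈ T ∧ ∃ z, (x, y, z) ∈ P} = {y} → g x = y := by
  classical
  let Q : Y → Set Y := fun x => {y | y ∈ T ∧ ∃ z, (x, y, z) ∈ P}
  let g : Y → Y := fun x => if h : ∃ y, Q x = {y} then h.choose else x
  have hg : ∀ x y, Q x = {y} → g x = y := fun x y hxy => by
    have h : ∃ y, Q x = {y} := ⟨y, hxy⟩
    have h1 : g x = h.choose := dif_pos h
    rw [h1]
    exact singleton_injective (h.choose_spec.symm.trans hxy)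
  -- Having exactly one point in the section is the event that its cardinality equals 1.
  have hD : NullMeasurableSet {x | ∃ y, Q x = {y}} ν := by
    have := (aemeasurable_card_section ν hP hT).nullMeasurable (measurableSet_singleton 1)
    convert this using 1
    ext x
    change (∃ y, Q x = {y}) ↔ card (Q x) = 1
    rw [← encard_eq_one, card]
    norm_cast
  have hnull : NullMeasurable g ν := by
    intro A hA
    have : g ⁻¹' A = ({x | ∃ y, Q x = {y}} ∩ {x | ∃ y ∈ T ∩ A, ∃ z, (x, y, z) ∈ P}) ∪
        ({x | ∃ y, Q x = {y}}ᶜ ∩ A) := by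
      ext x
      by_cases h : ∃ y, Q x = {y}
      · obtain ⟨y, hy⟩ := h
        have h1 : x ∈ {x | ∃ y, Q x = {y}} := ⟨y, hy⟩
        simp only [mem_preimage, hg x y hy, mem_union, mem_inter_iff, h1, mem_compl_iff,
          not_true_eq_false, false_and, or_false, true_and]
        constructor
        · intro hyA
          have : y ∈ Q x := by rw [hy]; rfl
          exact ⟨y, ⟨this.1, hyA⟩, this.2⟩
        · rintro ⟨y', ⟨h2, h3⟩, h4⟩
          have : y' ∈ Q x := ⟨h2, h4⟩
          rw [hy] at this
          exact this ▸ h3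
      · have h1 : x ∉ {x | ∃ y, Q x = {y}} := h
        have h2 : g x = x := dif_neg h
        simp only [mem_preimage, h2, mem_union, mem_inter_iff, h1, mem_compl_iff,
          not_false_eq_true, false_and, false_or, true_and]
    rw [this]
    exact (hD.inter (nullMeasurableSet_exists_exists ν hP (hT.inter hA))).union
      (hD.compl.inter hA.nullMeasurableSet)
  have hae := hnull.aemeasurable
  refine ⟨hae.mk g, hae.measurable_mk, ?_⟩
  filter_upwards [hae.ae_eq_mk] with x hx y hy
  rw [← hx]
  exact hg x y hy

/-- An analytic set all of whose sections are finite is a.e. covered by countably many graphs of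
Borel maps. -/
theorem exists_measurable_cover_of_finite_section (ν : Measure Y) [IsFiniteMeasure ν]
    {P : Set (Y × Y × Z)} (hP : MeasurableSet P) :
    ∃ g : ℕ → Y → Y, (∀ k, Measurable (g k)) ∧
      ∀ᵐ x ∂ν, {y | ∃ z, (x, y, z) ∈ P}.Finite → ∀ y z, (x, y, z) ∈ P → ∃ k, y = g k x := by
  -- One map for each code word. A code long enough to separate a finite section isolates each of
  -- its points in its own cell, where the singleton case applies.
  choose g hg hgx using fun q : Σ n : ℕ, Fin n → Bool =>
    exists_measurable_eq_of_section_singleton ν hP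
      (measurable_code q.1 (measurableSet_singleton q.2))
  obtain ⟨e, he⟩ := exists_surjective_nat (Σ n : ℕ, Fin n → Bool)
  refine ⟨fun k => g (e k), fun k => hg _, ?_⟩
  filter_upwards [ae_all_iff.2 hgx] with x hx hfin y z hyz
  obtain ⟨n, hn⟩ := exists_injOn_code hfin.toFinset
  obtain ⟨k, hk⟩ := he ⟨n, code Y n y⟩
  refine ⟨k, ?_⟩
  rw [hk]
  refine (hx ⟨n, code Y n y⟩ y ?_).symm
  rw [hfin.coe_toFinset] at hn
  ext y'
  constructor
  · rintro ⟨h1, h2⟩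
    exact hn h2 ⟨z, hyz⟩ h1
  · rintro rfl
    exact ⟨rfl, z, hyz⟩

theorem aemeasurable_tsum_section (ν : Measure X) [IsFiniteMeasure ν] {φ : X × Y → ℝ≥0∞}
    (hφ : Measurable φ) : AEMeasurable (fun x => ∑' y, φ (x, y)) ν := by
  refine hφ.ennreal_induction (motive := fun φ => AEMeasurable (fun x => ∑' y, φ (x, y)) ν)
    (fun c E hE => ?_) (fun f g _ hf hg hf' hg' => ?_) (fun f hf hmono hf' => ?_)
  -- The coordinate in `Unit` is a dummy that brings `E` into the form of a projected set.
  · have h1 : (fun x => ∑' y, E.indicator (fun _ => c) (x, y)) =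
        fun x => c * card {y | y ∈ univ ∧ ∃ z : Unit, (x, y, z) ∈
          (fun q : X × Y × Unit => (q.1, q.2.1)) ⁻¹' E} := by
      ext x
      rw [card_eq_tsum, ← ENNReal.tsum_mul_left]
      refine tsum_congr fun y => ?_
      by_cases h : (x, y) ∈ E <;> simp [h]
    rw [h1]
    refine (aemeasurable_card_section ν (MeasurableSet.preimage hE ?_)
      MeasurableSet.univ).const_mul c
    fun_prop
  · simp only [Pi.add_apply, ENNReal.tsum_add]
    exact hf'.add hg'
  · have h1 : ∀ x, ∑' y, ⨆ n, f n (x, y) = ⨆ n, ∑' y, f n (x, y) := fun x =>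
      tsum_iSup_of_monotone (f := fun n y => f n (x, y)) fun m n h y => hmono h (x, y)
    simp only [h1]
    exact AEMeasurable.iSup hf'

theorem aemeasurable_tsum_section_swap (ν : Measure X) [IsFiniteMeasure ν] {φ : Y × X → ℝ≥0∞}
    (hφ : Measurable φ) : AEMeasurable (fun x => ∑' y, φ (y, x)) ν :=
  aemeasurable_tsum_section ν (hφ.comp measurable_swap)

end Code

/-! ### Mass transport -/

section MassTransport

variable {Y : Type*} [MeasurableSpace Y] [StandardBorelSpace Y] {S : Setoid Y}
  {ν : Measure Y} [IsFiniteMeasure ν]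

/-- The mass transport principle. -/
theorem IsDiscreteMP.lintegral_tsum_comm (hS : IsDiscreteMP S ν) {φ : Y × Y → ℝ≥0∞}
    (hφ : Measurable φ) (hφS : ∀ q, φ q ≠ 0 → S q.1 q.2) :
    ∫⁻ x, ∑' y, φ (x, y) ∂ν = ∫⁻ y, ∑' x, φ (x, y) ∂ν := by
  -- Induction on measurable functions passes through functions not supported on `S`, hence the
  -- restriction to `S` inside the claim.
  have key : ∀ φ : Y × Y → ℝ≥0∞, Measurable φ →
      ∫⁻ x, ∑' y, {q : Y × Y | S q.1 q.2}.indicator φ (x, y) ∂ν =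
      ∫⁻ y, ∑' x, {q : Y × Y | S q.1 q.2}.indicator φ (x, y) ∂ν := by
    intro φ hφ
    refine hφ.ennreal_induction (motive := fun φ =>
      ∫⁻ x, ∑' y, {q : Y × Y | S q.1 q.2}.indicator φ (x, y) ∂ν =
      ∫⁻ y, ∑' x, {q : Y × Y | S q.1 q.2}.indicator φ (x, y) ∂ν)
      (fun c E hE => ?_) (fun f g _ hf hg hf' hg' => ?_) (fun f hf hmono hf' => ?_)
    · have hinv := hS.invariant (E ∩ {q : Y × Y | S q.1 q.2}) (hE.inter hS.measurableSet)
        fun q hq => hq.2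
      have h0 : ∀ q, {q : Y × Y | S q.1 q.2}.indicator (E.indicator fun _ => c) q =
          c * (E ∩ {q : Y × Y | S q.1 q.2}).indicator 1 q := fun q => by
        rw [indicator_indicator, inter_comm]
        by_cases h : q ∈ E ∩ {q : Y × Y | S q.1 q.2}
        · simp only [indicator_of_mem h, Pi.one_apply, mul_one]
        · simp only [indicator_of_notMem h, mul_zero]
      simp only [h0, ENNReal.tsum_mul_left]
      have hm : Measurable ((E ∩ {q : Y × Y | S q.1 q.2}).indicator (1 : Y × Y → ℝ≥0∞)) :=
        measurable_one.indicator (hE.inter hS.measurableSet)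
      rw [lintegral_const_mul'' _ (aemeasurable_tsum_section ν hm),
        lintegral_const_mul'' _ (aemeasurable_tsum_section_swap ν hm)]
      congr 1
      simp only [card_eq_tsum] at hinv
      exact hinv
    · simp only [indicator_add', Pi.add_apply, ENNReal.tsum_add]
      rw [lintegral_add_left' (aemeasurable_tsum_section ν (hf.indicator hS.measurableSet)),
        lintegral_add_left' (aemeasurable_tsum_section_swap ν (hf.indicator hS.measurableSet)),
        hf', hg']
    · have h0 : ∀ q, {q : Y × Y | S q.1 q.2}.indicator (fun x => ⨆ n, f n x) q =
          ⨆ n, {q : Y × Y | S q.1 q.2}.indicator (f n) q := fun q => by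
        by_cases h : q ∈ {q : Y × Y | S q.1 q.2}
        · simp only [indicator_of_mem h]
        · simp only [indicator_of_notMem h, iSup_const]
      have hm : ∀ {m n : ℕ}, m ≤ n → ∀ q, {q : Y × Y | S q.1 q.2}.indicator (f m) q ≤
          {q : Y × Y | S q.1 q.2}.indicator (f n) q := fun h q =>
        indicator_le_indicator (hmono h q)
      have h1 : ∀ x, ∑' y, ⨆ n, {q : Y × Y | S q.1 q.2}.indicator (f n) (x, y) =
          ⨆ n, ∑' y, {q : Y × Y | S q.1 q.2}.indicator (f n) (x, y) := fun x =>
        tsum_iSup_of_monotone (f := fun n y => {q : Y × Y | S q.1 q.2}.indicator (f n) (x, y))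
          fun m n h y => hm h _
      have h2 : ∀ y, ∑' x, ⨆ n, {q : Y × Y | S q.1 q.2}.indicator (f n) (x, y) =
          ⨆ n, ∑' x, {q : Y × Y | S q.1 q.2}.indicator (f n) (x, y) := fun y =>
        tsum_iSup_of_monotone (f := fun n x => {q : Y × Y | S q.1 q.2}.indicator (f n) (x, y))
          fun m n h x => hm h _
      simp only [h0, h1, h2]
      rw [lintegral_iSup' (fun n => aemeasurable_tsum_section ν
          ((hf n).indicator hS.measurableSet))
          (Eventually.of_forall fun x m n h => ENNReal.tsum_le_tsum fun y => hm h _),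
        lintegral_iSup' (fun n => aemeasurable_tsum_section_swap ν
          ((hf n).indicator hS.measurableSet))
          (Eventually.of_forall fun x m n h => ENNReal.tsum_le_tsum fun y => hm h _)]
      exact iSup_congr hf'
  have h0 : {q : Y × Y | S q.1 q.2}.indicator φ = φ := indicator_eq_self.2 fun q hq => hφS q hq
  simpa only [h0] using key φ hφ

/-- The saturation of a null set is a null set. -/
theorem IsDiscreteMP.ae_forall_rel (hS : IsDiscreteMP S ν) {p : Y → Prop}
    (hp : ∀ᵐ y ∂ν, p y) : ∀ᵐ x ∂ν, ∀ y, S x y → p y := by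
  obtain ⟨N, hN, hNm, hN0⟩ := exists_measurable_superset_of_null hp
  -- Each point sends mass 1 to every related point of `N`. Almost no point receives anything, so
  -- almost no point sends anything.
  let φ : Y × Y → ℝ≥0∞ := {q : Y × Y | S q.1 q.2 ∧ q.2 ∈ N}.indicator 1
  have hφ : Measurable φ :=
    measurable_one.indicator (hS.measurableSet.inter (hNm.preimage measurable_snd))
  have h := hS.lintegral_tsum_comm hφ fun q hq => by
    by_contra hc
    exact hq (indicator_of_notMem (fun h => hc h.1) _)
  have h0 : ∫⁻ y, ∑' x, φ (x, y) ∂ν = 0 := by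
    refine lintegral_eq_zero_of_ae_eq_zero ?_
    filter_upwards [compl_mem_ae_iff.2 hN0] with y hy
    simp only [Pi.zero_apply, ENNReal.tsum_eq_zero]
    exact fun x => indicator_of_notMem (fun h => hy h.2) _
  rw [h0, lintegral_eq_zero_iff' (aemeasurable_tsum_section ν hφ)] at h
  filter_upwards [h] with x hx y hxy
  by_contra hc
  have h1 := ENNReal.tsum_eq_zero.1 hx y
  have h2 : (x, y) ∈ {q : Y × Y | S q.1 q.2 ∧ q.2 ∈ N} := ⟨hxy, hN hc⟩
  simp only [φ, indicator_of_mem h2] at h1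
  exact one_ne_zero h1

end MassTransport

/-! ### Greedy selection and the covering lemma -/

/-- The total weight of the points `y ∈ A` for which `z ∈ U y`. -/
noncomputable def load {Y : Type*} (w : Y → ℝ≥0∞) (U : Y → Set Y) (A : Set Y) (z : Y) : ℝ≥0∞ :=
  ∑' y, {y | y ∈ A ∧ z ∈ U y}.indicator w y

theorem load_mono {Y : Type*} {w : Y → ℝ≥0∞} {U : Y → Set Y} {A B : Set Y} (h : A ⊆ B) (z : Y) :
    load w U A z ≤ load w U B z := by
  have : {y | y ∈ A ∧ z ∈ U y} ⊆ {y | y ∈ B ∧ z ∈ U y} := fun _ hy => ⟨h hy.1, hy.2⟩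
  exact ENNReal.tsum_le_tsum fun _ => indicator_le_indicator_of_subset this (fun _ => zero_le) _

theorem load_union_le {Y : Type*} {w : Y → ℝ≥0∞} {U : Y → Set Y} {A B : Set Y} (z : Y) :
    load w U (A ∪ B) z ≤ load w U A z + load w U B z := by
  rw [load, load, load, ← ENNReal.tsum_add]
  refine ENNReal.tsum_le_tsum fun y => ?_
  by_cases hz : z ∈ U y <;> by_cases hA : y ∈ A <;> by_cases hB : y ∈ B <;>
    simp [indicator, hz, hA, hB]

section Covering

variable {Y : Type*} [MeasurableSpace Y] [StandardBorelSpace Y] {S : Setoid Y}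
  {ν : Measure Y} [IsFiniteMeasure ν]

theorem aemeasurable_load {w : Y → ℝ≥0∞} (hw : Measurable w) {U : Y → Set Y}
    (hU : MeasurableSet {q : Y × Y | q.2 ∈ U q.1}) {A : Set Y} (hA : MeasurableSet A) :
    AEMeasurable (load w U A) ν :=
  aemeasurable_tsum_section_swap ν
    (φ := {q : Y × Y | q.1 ∈ A ∧ q.2 ∈ U q.1}.indicator fun q => w q.1)
    ((hw.comp measurable_fst).indicator ((hA.preimage measurable_fst).inter hU))

/-- Greedy selection, in the order of the rank `ρ`: a point `x` is discarded if the points selected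
before it have total weight larger than `1` at some point of `U x`. -/
theorem IsDiscreteMP.exists_greedy (hS : IsDiscreteMP S ν) {D : Set Y} (hD : MeasurableSet D)
    {ρ : Y → ℕ} (hρ : Measurable ρ) {U : Y → Set Y}
    (hU : MeasurableSet {q : Y × Y | q.2 ∈ U q.1}) (hUS : ∀ x, U x ⊆ cls S x)
    {w : Y → ℝ≥0∞} (hw : Measurable w) {g : ℕ → Y → Y} (hg : ∀ k, Measurable (g k))
    (hcov : ∀ᵐ x ∂ν, x ∈ D → ∀ z ∈ U x, ∃ k, z = g k x)
    (hload : ∀ᵐ z ∂ν, ∀ i, load w U (D ∩ ρ ⁻¹' {i}) z ≤ 1) (i : ℕ) :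
    ∃ A ⊆ D, MeasurableSet A ∧ (∀ x ∈ A, ρ x < i) ∧
      (∀ᵐ x ∂ν, x ∈ D → ρ x < i → x ∉ A → ∃ z ∈ U x, 1 < load w U (A ∩ {y | ρ y < ρ x}) z) ∧
      ∀ᵐ z ∂ν, load w U A z ≤ 2 := by
  induction i with
  | zero =>
    refine ⟨∅, empty_subset _, MeasurableSet.empty, by simp, by simp, ?_⟩
    simp [load]
  | succ i ih =>
    obtain ⟨A, hAD, hA, hAi, hdisc, hA2⟩ := ih
    have hae : AEMeasurable (load w U A) ν := aemeasurable_load hw hU hA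
    -- A Borel version of the load, tested only along the countably many maps `g k`, keeps the
    -- selected set Borel. Saturation of null sets lets it be exchanged for the true load on all of
    -- `U x`.
    let h := hae.mk (load w U A)
    have hh : Measurable h := hae.measurable_mk
    let A' : Set Y := {x | x ∈ D ∧ ρ x = i ∧ ∀ k, g k x ∈ U x → h (g k x) ≤ 1}
    have hA' : MeasurableSet A' := by
      suffices h0 : MeasurableSet {x | ∀ k, g k x ∈ U x → h (g k x) ≤ 1} from
        hD.inter ((hρ (measurableSet_singleton i)).inter h0)
      rw [ofPred_forall]
      refine MeasurableSet.iInter fun k => ?_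
      have h1 : MeasurableSet {x | g k x ∈ U x} := hU.preimage (measurable_id.prodMk (hg k))
      have h2 : MeasurableSet {x | h (g k x) ≤ 1} :=
        measurableSet_le (hh.comp (hg k)) measurable_const
      exact h1.imp h2
    refine ⟨A ∪ A', union_subset hAD fun x hx => hx.1, hA.union hA', ?_, ?_, ?_⟩
    · rintro x (hx | hx)
      · exact (hAi x hx).trans (Nat.lt_succ_self i)
      · exact hx.2.1 ▸ Nat.lt_succ_self i
    · filter_upwards [hdisc, hS.ae_forall_rel hae.ae_eq_mk] with x hx hxh hxD hxi hxA
      rw [mem_union, not_or] at hxA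
      rcases Nat.lt_succ_iff_lt_or_eq.1 hxi with hlt | heq
      · obtain ⟨z, hz, hz1⟩ := hx hxD hlt hxA.1
        exact ⟨z, hz, hz1.trans_le (load_mono (inter_subset_inter_left _ subset_union_left) z)⟩
      · have : ∃ k, g k x ∈ U x ∧ 1 < h (g k x) := by
          by_contra! hc
          exact hxA.2 ⟨hxD, heq, hc⟩
        obtain ⟨k, hk, hk1⟩ := this
        refine ⟨g k x, hk, ?_⟩
        rw [show h (g k x) = load w U A (g k x) from (hxh _ (hUS x hk)).symm] at hk1
        exact hk1.trans_le (load_mono (show A ⊆ (A ∪ A') ∩ {y | ρ y < ρ x} from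
          fun y hy => ⟨Or.inl hy, heq ▸ hAi y hy⟩) _)
    -- If a newly selected `y` has `z ∈ U y`, the old load at `z` was at most 1 by the selection
    -- rule, and one rank adds at most 1. Otherwise the load at `z` is unchanged.
    · filter_upwards [hA2, hload, hae.ae_eq_mk, hS.ae_forall_rel hcov] with z hz hzl hzh hzc
      refine (load_union_le z).trans ?_
      have hle : load w U A' z ≤ 1 := (load_mono
        (show A' ⊆ D ∩ ρ ⁻¹' {i} from fun y hy => ⟨hy.1, hy.2.1⟩) z).trans (hzl i)
      by_cases hex : ∃ y ∈ A', z ∈ U y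
      · obtain ⟨y, hy, hyz⟩ := hex
        obtain ⟨k, rfl⟩ := hzc y (S.symm (hUS y hyz)) hy.1 z hyz
        have h1 : load w U A (g k y) ≤ 1 := hzh ▸ hy.2.2 k hyz
        exact (add_le_add h1 hle).trans one_add_one_eq_two.le
      · have h0 : load w U A' z = 0 := by
          refine ENNReal.tsum_eq_zero.2 fun y => ?_
          have : y ∉ {y | y ∈ A' ∧ z ∈ U y} := fun hy => hex ⟨y, hy⟩
          exact indicator_of_notMem this _
        rw [h0, add_zero]
        exact hz

/-- The covering lemma behind the maximal inequality. -/
theorem IsDiscreteMP.covering (hS : IsDiscreteMP S ν) {D : Set Y} (hD : MeasurableSet D)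
    {ρ : Y → ℕ} (hρ : Measurable ρ) {L : ℕ} (hL : ∀ x ∈ D, ρ x < L) {U : Y → Set Y}
    (hU : MeasurableSet {q : Y × Y | q.2 ∈ U q.1}) (hUS : ∀ x, U x ⊆ cls S x)
    {w : Y → ℝ≥0∞} (hw : Measurable w) {g : ℕ → Y → Y} (hg : ∀ k, Measurable (g k))
    (hcov : ∀ᵐ x ∂ν, x ∈ D → ∀ z ∈ U x, ∃ k, z = g k x)
    (hload : ∀ᵐ z ∂ν, ∀ i, load w U (D ∩ ρ ⁻¹' {i}) z ≤ 1)
    {a b : ℝ≥0} (ha : ∀ᵐ x ∂ν, x ∈ D → 1 ≤ a * (w x * card (U x)))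
    (hb : ∀ᵐ y ∂ν, y ∈ D →
      card {x | x ∈ D ∧ ρ y < ρ x ∧ (U x ∩ U y).Nonempty} ≤ b * card (U y))
    {f : Y → ℝ≥0∞} (hf : Measurable f) {t : ℝ≥0∞}
    (ht : ∀ᵐ x ∂ν, x ∈ D → t * card (U x) ≤ ∑' z, (U x).indicator f z) :
    t * ν D ≤ (a + b) * 2 * ∫⁻ z, f z ∂ν := by
  obtain ⟨A, hAD, hA, -, hdisc, hA2⟩ := hS.exists_greedy hD hρ hU hUS hw hg hcov hload L
  let J : ℝ≥0∞ := ∫⁻ y, A.indicator (fun y => w y * card (U y)) y ∂ν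
  have hνA : ν A ≤ a * J := by
    rw [← lintegral_indicator_one hA, ← lintegral_const_mul' _ _ ENNReal.coe_ne_top]
    refine lintegral_mono_ae ?_
    filter_upwards [ha] with x hx
    by_cases hxA : x ∈ A
    · simpa [hxA] using hx (hAD hxA)
    · simp [hxA]
  have hνDA : ν (D \ A) ≤ b * J := by
    -- A discarded `x` charges `w y` to each selected `y` of smaller rank whose set meets `U x`
    -- along some `g k`. By the discarding rule the charges of `x` exceed 1 in total.
    let V : Set (Y × Y) := {q | q.1 ∈ D \ A ∧ q.2 ∈ A ∧ ρ q.2 < ρ q.1 ∧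
      ∃ k, g k q.1 ∈ U q.1 ∧ g k q.1 ∈ U q.2}
    have hV : MeasurableSet V := by
      suffices h0 : MeasurableSet {q : Y × Y | ∃ k, g k q.1 ∈ U q.1 ∧ g k q.1 ∈ U q.2} from
        ((hD.diff hA).preimage measurable_fst).inter
        ((hA.preimage measurable_snd).inter ((measurableSet_lt (hρ.comp measurable_snd)
          (hρ.comp measurable_fst)).inter h0))
      rw [ofPred_exists]
      refine MeasurableSet.iUnion fun k => ?_
      exact (hU.preimage (measurable_fst.prodMk ((hg k).comp measurable_fst))).inter
        (hU.preimage (measurable_snd.prodMk ((hg k).comp measurable_fst)))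
    have hΦ : Measurable (V.indicator fun q => w q.2) := (hw.comp measurable_snd).indicator hV
    have h1 : ν (D \ A) ≤ ∫⁻ x, ∑' y, V.indicator (fun q => w q.2) (x, y) ∂ν := by
      rw [← lintegral_indicator_one (hD.diff hA)]
      refine lintegral_mono_ae ?_
      filter_upwards [hdisc, hcov] with x hx hxc
      by_cases hxD : x ∈ D \ A
      swap
      · simp [hxD]
      obtain ⟨z, hz, hz1⟩ := hx hxD.1 (hL x hxD.1) hxD.2
      obtain ⟨k, rfl⟩ := hxc hxD.1 z hz
      rw [indicator_of_mem hxD, Pi.one_apply]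
      refine hz1.le.trans (ENNReal.tsum_le_tsum fun y => ?_)
      by_cases hy : y ∈ {y | y ∈ A ∩ {y | ρ y < ρ x} ∧ g k x ∈ U y}
      · have : (x, y) ∈ V := ⟨hxD, hy.1.1, hy.1.2, k, hz, hy.2⟩
        rw [indicator_of_mem this, indicator_of_mem hy]
      · rw [indicator_of_notMem hy]
        exact zero_le
    refine h1.trans ?_
    -- Seen from the receiving end, `y` collects `w y` times the number of points charging it, which
    -- is controlled by `hb`.
    rw [hS.lintegral_tsum_comm hΦ, ← lintegral_const_mul' _ _ ENNReal.coe_ne_top]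
    · refine lintegral_mono_ae ?_
      filter_upwards [hb] with y hy
      by_cases hyA : y ∈ A
      · rw [indicator_of_mem hyA, mul_left_comm]
        refine le_trans ?_ (mul_le_mul_right (hy (hAD hyA)) (w y))
        rw [card_eq_tsum, ← ENNReal.tsum_mul_left]
        refine ENNReal.tsum_le_tsum fun x => ?_
        by_cases hxy : (x, y) ∈ V
        · obtain ⟨k, hk⟩ := hxy.2.2.2
          have : x ∈ {x | x ∈ D ∧ ρ y < ρ x ∧ (U x ∩ U y).Nonempty} :=
            ⟨hxy.1.1, hxy.2.2.1, _, hk⟩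
          rw [indicator_of_mem this, indicator_of_mem hxy, Pi.one_apply, mul_one]
        · rw [indicator_of_notMem hxy]
          exact zero_le
      · have h0 : ∑' x, V.indicator (fun q => w q.2) (x, y) = 0 :=
          ENNReal.tsum_eq_zero.2 fun x => indicator_of_notMem (fun h => hyA h.2.1) _
        rw [h0]
        exact zero_le
    · intro q hq
      have hqV : q ∈ V := by
        by_contra hc
        exact hq (indicator_of_notMem hc _)
      obtain ⟨-, -, -, k, h1, h2⟩ := hqV
      exact S.trans (hUS _ h1) (S.symm (hUS _ h2))
  have hJ : t * J ≤ 2 * ∫⁻ z, f z ∂ν := by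
    -- Summing `w y * f z` over pairs with `z ∈ U y` and exchanging the order of summation produces
    -- the load, which is at most 2.
    let V : Set (Y × Y) := {q | q.1 ∈ A ∧ q.2 ∈ U q.1}
    have hV : MeasurableSet V := (hA.preimage measurable_fst).inter hU
    have hΨ : Measurable (V.indicator fun q => w q.1 * f q.2) :=
      ((hw.comp measurable_fst).mul (hf.comp measurable_snd)).indicator hV
    calc t * J ≤ ∫⁻ y, t * A.indicator (fun y => w y * card (U y)) y ∂ν :=
          lintegral_const_mul_le _ _
      _ ≤ ∫⁻ y, ∑' z, V.indicator (fun q => w q.1 * f q.2) (y, z) ∂ν := by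
          refine lintegral_mono_ae ?_
          filter_upwards [ht] with y hy
          by_cases hyA : y ∈ A
          · rw [indicator_of_mem hyA, mul_left_comm]
            refine (mul_le_mul_right (hy (hAD hyA)) (w y)).trans ?_
            rw [← ENNReal.tsum_mul_left]
            refine ENNReal.tsum_le_tsum fun z => ?_
            by_cases hz : z ∈ U y
            · have : (y, z) ∈ V := ⟨hyA, hz⟩
              rw [indicator_of_mem hz, indicator_of_mem this]
            · simp [hz]
          · simp [hyA]
      _ = ∫⁻ z, ∑' y, V.indicator (fun q => w q.1 * f q.2) (y, z) ∂ν := by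
          refine hS.lintegral_tsum_comm hΨ fun q hq => ?_
          have hqV : q ∈ V := by
            by_contra hc
            exact hq (indicator_of_notMem hc _)
          exact hUS _ hqV.2
      _ = ∫⁻ z, load w U A z * f z ∂ν := by
          refine lintegral_congr fun z => ?_
          rw [load, ← ENNReal.tsum_mul_right]
          refine tsum_congr fun y => ?_
          by_cases h : y ∈ A ∧ z ∈ U y
          · have h1 : (y, z) ∈ V := h
            have h2 : y ∈ {y | y ∈ A ∧ z ∈ U y} := h
            rw [indicator_of_mem h1, indicator_of_mem h2]
          · have h1 : (y, z) ∉ V := h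
            have h2 : y ∉ {y | y ∈ A ∧ z ∈ U y} := h
            rw [indicator_of_notMem h1, indicator_of_notMem h2, zero_mul]
      _ ≤ ∫⁻ z, 2 * f z ∂ν := by
          refine lintegral_mono_ae ?_
          filter_upwards [hA2] with z hz
          gcongr
      _ = 2 * ∫⁻ z, f z ∂ν := lintegral_const_mul _ hf
  calc t * ν D ≤ t * (ν A + ν (D \ A)) := by
        gcongr
        refine (measure_mono ?_).trans (measure_union_le A (D \ A))
        rw [union_sdiff_self]
        exact subset_union_right
    _ ≤ t * (a * J + b * J) := by gcongr
    _ = (a + b) * (t * J) := by ring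
    _ ≤ (a + b) * (2 * ∫⁻ z, f z ∂ν) := by gcongr
    _ = (a + b) * 2 * ∫⁻ z, f z ∂ν := by ring

end Covering

/-! ### Borel families: measurability of averages and of the maximal function -/

/-- The enumeration may repeat points, so only first occurrences are counted. This writes sums over
varying sets as series of Borel functions. -/
theorem tsum_indicator_eq_tsum_nat {Y : Type*} (φ : Y → ℝ≥0∞) {V : Set Y} {a : ℕ → Y}
    (hV : ∀ z ∈ V, ∃ k, z = a k) :
    ∑' z, V.indicator φ z =
      ∑' k, {k | a k ∈ V ∧ ∀ j < k, a j ≠ a k}.indicator (fun k => φ (a k)) k := by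
  rw [← tsum_subtype, ← tsum_subtype]
  let e : {k | a k ∈ V ∧ ∀ j < k, a j ≠ a k} → V := fun k => ⟨a k, k.2.1⟩
  have he : Function.Bijective e := by
    classical
    constructor
    · rintro ⟨k, hk⟩ ⟨l, hl⟩ h
      have h' : a k = a l := congrArg Subtype.val h
      rcases lt_trichotomy k l with h1 | h1 | h1
      · exact absurd h' (hl.2 k h1)
      · exact Subtype.ext h1
      · exact absurd h'.symm (hk.2 l h1)
    · rintro ⟨z, hz⟩
      have hex : ∃ k, a k = z := (hV z hz).imp fun _ h => h.symm
      have hf : a (Nat.find hex) = z := Nat.find_spec hex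
      refine ⟨⟨Nat.find hex, ?_, fun j hj h => ?_⟩, Subtype.ext hf⟩
      · exact hf.symm ▸ hz
      · exact Nat.find_min hex hj (h.trans hf)
  exact ((Equiv.ofBijective e he).tsum_eq fun z : V => φ z).symm

/-- The average of `f` over `V`. -/
noncomputable def avg {Y : Type*} (f : Y → ℝ≥0∞) (V : Set Y) : ℝ≥0∞ :=
  (∑' z, V.indicator f z) / card V

/-- A Borel family of subset functions, with the finiteness condition only almost everywhere. -/
structure IsAEFamily {Y : Type*} [MeasurableSpace Y] (S : Setoid Y) (ν : Measure Y) {I : Set ℝ}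
    (G : I → Y → Set Y) : Prop where
  subset_cls : ∀ r x, G r x ⊆ cls S x
  measurableSet : MeasurableSet {q : Y × Y × I | q.2.1 ∈ G q.2.2 q.1}
  finite : ∀ᵐ x ∂ν, ∀ r, (⋃ s ≤ r, G s x).Finite

theorem IsAEFamily.finite_section {Y : Type*} [MeasurableSpace Y] {S : Setoid Y} {ν : Measure Y}
    {I : Set ℝ} {G : I → Y → Set Y} (hG : IsAEFamily S ν G) :
    ∀ᵐ x ∂ν, ∀ r, (G r x).Finite := by
  filter_upwards [hG.finite] with x hx r
  exact (hx r).subset fun y hy => mem_iUnion₂.2 ⟨r, le_rfl, hy⟩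

section Family

variable {Y : Type*} [MeasurableSpace Y] [StandardBorelSpace Y] {S : Setoid Y}
  {ν : Measure Y} [IsFiniteMeasure ν] {I : Set ℝ} {G : I → Y → Set Y}

/-- For indices bounded by `n` the union of the sets at `x` is finite a.e., because some index lies
above `n`; the countable covers for all `n` are then merged. -/
theorem IsAEFamily.exists_cover (hG : IsAEFamily S ν G) (hI : MeasurableSet I)
    (hIn : ∀ n : ℕ, ∃ r : I, (n : ℝ) ≤ r) :
    ∃ g : ℕ → Y → Y, (∀ k, Measurable (g k)) ∧
      ∀ᵐ x ∂ν, ∀ r, ∀ z ∈ G r x, ∃ k, z = g k x := by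
  have : StandardBorelSpace I := hI.standardBorel
  have hP : ∀ n : ℕ, MeasurableSet {q : Y × Y × I | q.2.1 ∈ G q.2.2 q.1 ∧ (q.2.2 : ℝ) ≤ n} :=
    fun n => hG.measurableSet.inter (measurableSet_le
      (measurable_subtype_coe.comp (measurable_snd.comp measurable_snd)) measurable_const)
  choose g hg hgx using fun n => exists_measurable_cover_of_finite_section ν (hP n)
  refine ⟨fun k => g k.unpair.1 k.unpair.2, fun k => hg _ _, ?_⟩
  filter_upwards [ae_all_iff.2 hgx, hG.finite] with x hx hfin r z hz
  obtain ⟨n, hn⟩ := exists_nat_ge (r : ℝ)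
  have hn' : {y | ∃ i : I, (x, y, i) ∈
      {q : Y × Y × I | q.2.1 ∈ G q.2.2 q.1 ∧ (q.2.2 : ℝ) ≤ n}}.Finite := by
    obtain ⟨s, hs⟩ := hIn n
    refine (hfin s).subset ?_
    rintro y ⟨i, hi, hin⟩
    exact mem_iUnion₂.2 ⟨i, hin.trans hs, hi⟩
  obtain ⟨k, hk⟩ := hx n hn' z r ⟨hz, hn⟩
  exact ⟨Nat.pair n k, by simpa using hk⟩

/-- The exceptional null set does not depend on `r`, which is essential when `I` is uncountable. -/
theorem IsAEFamily.exists_measurable_avg (hG : IsAEFamily S ν G) (hI : MeasurableSet I)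
    (hIn : ∀ n : ℕ, ∃ r : I, (n : ℝ) ≤ r) {f : Y → ℝ≥0∞} (hf : Measurable f) :
    ∃ φ : Y × I → ℝ≥0∞, Measurable φ ∧ ∀ᵐ x ∂ν, ∀ r, avg f (G r x) = φ (x, r) := by
  obtain ⟨g, hg, hcov⟩ := hG.exists_cover hI hIn
  let σ : (Y → ℝ≥0∞) → Y × I → ℝ≥0∞ := fun f q =>
    ∑' k, {k | g k q.1 ∈ G q.2 q.1 ∧ ∀ j < k, g j q.1 ≠ g k q.1}.indicator
      (fun k => f (g k q.1)) k
  have hσ : ∀ {f}, Measurable f → Measurable (σ f) := by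
    intro f hf
    refine Measurable.tsum fun k => ?_
    have hset : MeasurableSet {q : Y × I | g k q.1 ∈ G q.2 q.1 ∧ ∀ j < k, g j q.1 ≠ g k q.1} := by
      have h1 : MeasurableSet {q : Y × I | g k q.1 ∈ G q.2 q.1} :=
        hG.measurableSet.preimage (measurable_fst.prodMk
          (((hg k).comp measurable_fst).prodMk measurable_snd))
      have h2 : MeasurableSet {q : Y × I | ∀ j < k, g j q.1 ≠ g k q.1} := by
        rw [ofPred_forall]
        refine MeasurableSet.iInter fun j => ?_
        rw [ofPred_forall]
        refine MeasurableSet.iInter fun _ => ?_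
        exact (measurableSet_eq_fun ((hg j).comp measurable_fst)
          ((hg k).comp measurable_fst)).compl
      exact h1.inter h2
    exact (hf.comp ((hg k).comp measurable_fst)).indicator hset
  refine ⟨fun q => σ f q / σ 1 q, (hσ hf).div (hσ measurable_one), ?_⟩
  filter_upwards [hcov] with x hx r
  rw [avg, card_eq_tsum, tsum_indicator_eq_tsum_nat f (hx r), tsum_indicator_eq_tsum_nat 1 (hx r)]

/-- The maximal function is universally measurable. -/
theorem IsAEFamily.aemeasurable_iSup_avg (hG : IsAEFamily S ν G) (hI : MeasurableSet I)
    (hIn : ∀ n : ℕ, ∃ r : I, (n : ℝ) ≤ r) {f : Y → ℝ≥0∞} (hf : Measurable f) :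
    AEMeasurable (fun x => ⨆ r, avg f (G r x)) ν := by
  have : StandardBorelSpace I := hI.standardBorel
  obtain ⟨φ, hφ, hφx⟩ := hG.exists_measurable_avg hI hIn hf
  have h1 : AEMeasurable (fun x => ⨆ r, φ (x, r)) ν := by
    suffices h : Measurable (fun x => ⨆ r, φ (x, r) : NullMeasurableSpace Y ν → ℝ≥0∞) from
      NullMeasurable.aemeasurable fun s hs => h hs
    refine measurable_of_Ioi fun t => ?_
    -- The superlevel set of a supremum over `r` is a projection of a Borel set.
    have : (fun x => ⨆ r, φ (x, r)) ⁻¹' Ioi t = Prod.fst '' (φ ⁻¹' Ioi t) := by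
      ext x
      simp only [mem_preimage, mem_Ioi, lt_iSup_iff, mem_image, Prod.exists, exists_and_right,
        exists_eq_right]
    have h0 : NullMeasurableSet ((fun x => ⨆ r, φ (x, r)) ⁻¹' Ioi t) ν :=
      this ▸ nullMeasurableSet_image ν measurable_fst (hφ measurableSet_Ioi)
    exact h0
  refine h1.congr ?_
  filter_upwards [hφx] with x hx
  exact iSup_congr fun r => (hx r).symm

/-- To bound the measure of the set where the maximal function is large, it suffices to bound the
measures of the sets on which a large average can be selected measurably. -/
theorem IsAEFamily.mul_measure_le_of_selection (hG : IsAEFamily S ν G) (hI : MeasurableSet I)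
    (hIn : ∀ n : ℕ, ∃ r : I, (n : ℝ) ≤ r) {f : Y → ℝ≥0∞} (hf : Measurable f) {t M : ℝ≥0∞}
    (h : ∀ (D : Set Y) (r : Y → I), MeasurableSet D → Measurable r →
      (∀ᵐ x ∂ν, x ∈ D → t < avg f (G (r x) x)) → t * ν D ≤ M) :
    t * ν {x | t < ⨆ r, avg f (G r x)} ≤ M := by
  have : StandardBorelSpace I := hI.standardBorel
  obtain ⟨φ, hφ, hφx⟩ := hG.exists_measurable_avg hI hIn hf
  let P : Set (Y × ℝ) := Prod.map id Subtype.val '' (φ ⁻¹' Ioi t)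
  have hP : MeasurableSet P :=
    (MeasurableEmbedding.id.prodMap (MeasurableEmbedding.subtype_coe hI)).measurableSet_image.2
      (hφ measurableSet_Ioi)
  have hPE : ν {x | t < ⨆ r, avg f (G r x)} = ν (Prod.fst '' P) := by
    refine measure_congr ?_
    filter_upwards [hφx] with x hx
    refine propext ?_
    change (t < ⨆ r, avg f (G r x)) ↔ x ∈ Prod.fst '' P
    simp only [hx, lt_iSup_iff]
    constructor
    · rintro ⟨r, hr⟩
      exact ⟨(x, r), ⟨(x, r), hr, rfl⟩, rfl⟩
    · rintro ⟨_, ⟨⟨y, r⟩, hr, rfl⟩, rfl⟩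
      exact ⟨r, hr⟩
  rw [hPE]
  rcases eq_or_ne (ν (Prod.fst '' P)) 0 with h0 | h0
  · rw [h0, mul_zero]
    exact zero_le
  -- The selection succeeds on sets whose measure is as close as desired to that of the projection,
  -- so the bound passes to the limit.
  obtain ⟨u, -, hu, hlim⟩ := exists_seq_strictMono_tendsto' (pos_iff_ne_zero.2 h0)
  refine le_of_tendsto (ENNReal.Tendsto.const_mul hlim (Or.inl h0))
    (Eventually.of_forall fun n => ?_)
  obtain ⟨D, r, hD, hr, hrP, hle⟩ := exists_measurable_selection ν hP (hu n).2
  obtain ⟨i₀, -⟩ := hIn 0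
  classical
  -- The selected value is known to lie in `I` only on `D`; elsewhere an arbitrary index `i₀` is
  -- used.
  have hr' : Measurable fun x => if r x ∈ I then r x else i₀ :=
    Measurable.ite (hr hI) hr measurable_const
  have hmem : ∀ x, (if r x ∈ I then r x else (i₀ : ℝ)) ∈ I := fun x => by
    split_ifs with hx
    · exact hx
    · exact i₀.2
  refine (mul_le_mul_right hle t).trans
    (h D (fun x => ⟨_, hmem x⟩) hD (hr'.subtype_mk) ?_)
  filter_upwards [hφx] with x hx hxD
  obtain ⟨⟨y, i⟩, hyi, heq⟩ := hrP x hxD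
  obtain ⟨rfl, hi⟩ : y = x ∧ (i : ℝ) = r x := Prod.ext_iff.1 heq
  have h1 : (⟨_, hmem y⟩ : I) = i := by
    refine Subtype.ext ?_
    simp only [← hi, i.2, if_true]
  rw [hx, h1]
  exact hyi

end Family

/-! ### The weak type (1,1) inequality for regular and for tempered families -/

theorem mul_card_le_of_lt_avg {Y : Type*} {f : Y → ℝ≥0∞} {V : Set Y} {t : ℝ≥0∞}
    (h : t < avg f V) : t * card V ≤ ∑' z, V.indicator f z :=
  ENNReal.mul_le_of_le_div h.le

theorem nonempty_of_lt_avg {Y : Type*} {f : Y → ℝ≥0∞} {V : Set Y} {t : ℝ≥0∞}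
    (h : t < avg f V) : V.Nonempty := by
  rw [nonempty_iff_ne_empty]
  rintro rfl
  simp [avg] at h

theorem one_le_card {Y : Type*} {V : Set Y} (h : V.Nonempty) : 1 ≤ card V := by
  have : (1 : ℕ∞) ≤ V.encard := one_le_encard_iff_nonempty.2 h
  rw [card]
  exact_mod_cast this

theorem card_ne_top {Y : Type*} {V : Set Y} (h : V.Finite) : card V ≠ ∞ := by
  rw [card]
  exact_mod_cast h.encard_lt_top.ne

theorem finite_of_card_ne_top {Y : Type*} {V : Set Y} (h : card V ≠ ∞) : V.Finite := by
  refine encard_ne_top_iff.1 fun h' => h ?_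
  rw [card, h']
  rfl

/-- Continuity from below of a measure, in the form used to exhaust a set. -/
theorem mul_measure_le_of_forall_nat {Y : Type*} [MeasurableSpace Y] {ν : Measure Y}
    {D : Set Y} {E : ℕ → Set Y} (hE : Monotone E) (hD : ∀ᵐ x ∂ν, x ∈ D → ∃ n, x ∈ E n)
    {t M : ℝ≥0∞} (h : ∀ n, t * ν (E n) ≤ M) : t * ν D ≤ M := by
  have h1 : ν D ≤ ν (⋃ n, E n) := by
    refine measure_mono_ae ?_
    filter_upwards [hD] with x hx hxD
    exact mem_iUnion.2 (hx hxD)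
  refine (mul_le_mul_right h1 t).trans ?_
  rw [hE.measure_iUnion, ENNReal.mul_iSup]
  exact iSup_le h

theorem IsAEFamily.measurableSet_comp {Y : Type*} [MeasurableSpace Y] {S : Setoid Y}
    {ν : Measure Y} {I : Set ℝ} {G : I → Y → Set Y} (hG : IsAEFamily S ν G)
    {r : Y → I} (hr : Measurable r) :
    MeasurableSet {q : Y × Y | q.2 ∈ G (r q.1) q.1} :=
  hG.measurableSet.preimage (measurable_fst.prodMk (measurable_snd.prodMk
    (hr.comp measurable_fst)))

section WeakType

variable {Y : Type*} [MeasurableSpace Y] [StandardBorelSpace Y] {S : Setoid Y}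
  {ν : Measure Y} [IsFiniteMeasure ν] {I : Set ℝ} {G : I → Y → Set Y}

/-- The number of the first `K` members of `q` that lie below `s`. -/
noncomputable def level (q : ℕ → ℝ) (K : ℕ) (s : ℝ) : ℕ :=
  ∑ j ∈ Finset.range K, if q j < s then 1 else 0

theorem level_le (q : ℕ → ℝ) (K : ℕ) (s : ℝ) : level q K s ≤ K := by
  refine (Finset.sum_le_sum (g := fun _ => 1) fun j _ => ?_).trans (by simp)
  split_ifs <;> simp

/-- With `q` dense, this shows that the integer-valued levels eventually resolve any strict
inequality between two real indices. -/
theorem level_lt {q : ℕ → ℝ} {K j : ℕ} (hj : j < K) {s s' : ℝ} (h : s ≤ q j) (h' : q j < s') :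
    level q K s < level q K s' := by
  refine Finset.sum_lt_sum (fun i _ => ?_) ⟨j, Finset.mem_range.2 hj, ?_⟩
  · by_cases hi : q i < s
    · simp [hi, hi.trans (h.trans_lt h')]
    · simp [hi]
  · simp [h', h.not_gt]

theorem measurable_level (q : ℕ → ℝ) (K : ℕ) : Measurable (level q K) :=
  Finset.measurable_fun_sum _ fun _ _ =>
    Measurable.ite measurableSet_Ioi measurable_const measurable_const

/-- After discarding a set of small measure, the points of `D` can be ranked such that, among
points `x` with intersecting sets `G (r x) x`, different points have different ranks and larger
rank means smaller index `r x`. -/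
theorem IsAEFamily.exists_rank (hG : IsAEFamily S ν G) {D : Set Y} (hD : MeasurableSet D)
    {r : Y → I} (hr : Measurable r)
    (hfin : ∀ᵐ x ∂ν, {y | r y ≤ r x ∧ (G (r y) y ∩ G (r x) x).Nonempty}.Finite) :
    ∃ (E : ℕ → Set Y) (ρ : ℕ → Y → ℕ) (L : ℕ → ℕ), Monotone E ∧
      (∀ᵐ x ∂ν, x ∈ D → ∃ n, x ∈ E n) ∧ (∀ n, E n ⊆ D) ∧ (∀ n, NullMeasurableSet (E n) ν) ∧
      (∀ n, Measurable (ρ n)) ∧ (∀ n x, ρ n x < L n) ∧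
      (∀ n, ∀ x ∈ E n, ∀ y ∈ E n, x ≠ y → (G (r x) x ∩ G (r y) y).Nonempty → ρ n x ≠ ρ n y) ∧
      (∀ n, ∀ x ∈ E n, ∀ y ∈ E n, (G (r x) x ∩ G (r y) y).Nonempty → ρ n y < ρ n x →
        r x ≤ r y) := by
  obtain ⟨q, hq⟩ := TopologicalSpace.exists_dense_seq ℝ
  let lev : ℕ → Y → ℕ := fun K x => level q K (r x)
  have hlev : ∀ K, Measurable (lev K) := fun K =>
    (measurable_level q K).comp (measurable_subtype_coe.comp hr)
  let N : Y → Set Y := fun x =>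
    {y | y ∈ D ∧ y ≠ x ∧ r y ≤ r x ∧ (G (r y) y ∩ G (r x) x).Nonempty}
  -- Points for which resolution `K` is fine enough: relative to every point of no larger index with
  -- intersecting set, the codes differ and strict index inequalities show in the levels.
  let E : ℕ → Set Y := fun K => {x | x ∈ D ∧ ∀ y ∈ N x, code Y K y ≠ code Y K x ∧
    (r y < r x → lev K y < lev K x)}
  have hlevmono : ∀ {K K' : ℕ}, K ≤ K' → ∀ {x y}, r y ≤ r x → lev K y < lev K x →
      lev K' y < lev K' x := by
    intro K K' hK x y hrxy hlt
    have : ∃ j < K, (r y : ℝ) ≤ q j ∧ q j < r x := by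
      by_contra! hc
      refine hlt.not_ge (Finset.sum_le_sum fun j hj => ?_)
      by_cases h1 : q j < (r y : ℝ)
      · simp only [h1, if_true]
        split_ifs <;> simp
      · have := hc j (Finset.mem_range.1 hj) (not_lt.1 h1)
        simp [this.not_gt]
    obtain ⟨j, hj, h1, h2⟩ := this
    exact level_lt (hj.trans_le hK) h1 h2
  let e : ∀ K : ℕ, (Fin K → Bool) ≃ Fin (Fintype.card (Fin K → Bool)) := fun K =>
    Fintype.equivFin _
  let m : ℕ → ℕ := fun K => Fintype.card (Fin K → Bool)
  -- Lexicographic rank: the reversed level is the leading digit, so higher levels come first, and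
  -- the code is the remainder modulo `m K`, breaking ties.
  let ρ : ℕ → Y → ℕ := fun K x => e K (code Y K x) + m K * (K - lev K x)
  have hmod : ∀ K x, ρ K x % m K = e K (code Y K x) := fun K x => by
    simp only [ρ, Nat.add_mul_mod_self_left]
    exact Nat.mod_eq_of_lt (e K (code Y K x)).2
  have hρlt : ∀ {K x y}, lev K y < lev K x → ρ K x < ρ K y := by
    intro K x y h
    have h1 : lev K x ≤ K := level_le q K _
    have h2 : (K - lev K x) + 1 ≤ K - lev K y := by omega
    have h3 : (e K (code Y K x) : ℕ) < m K := (e K (code Y K x)).2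
    calc ρ K x < m K + m K * (K - lev K x) := Nat.add_lt_add_right h3 _
      _ = m K * ((K - lev K x) + 1) := by ring
      _ ≤ m K * (K - lev K y) := Nat.mul_le_mul_left _ h2
      _ ≤ ρ K y := Nat.le_add_left _ _
  refine ⟨E, ρ, fun K => m K + m K * K, ?_, ?_, fun K x hx => hx.1, ?_, ?_, ?_, ?_, ?_⟩
  · rintro K K' hK x ⟨hxD, hx⟩
    refine ⟨hxD, fun y hy => ⟨fun hc => (hx y hy).1 (code_eq_of_le hK hc), fun hlt => ?_⟩⟩
    exact hlevmono hK hlt.le ((hx y hy).2 hlt)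
  · filter_upwards [hfin] with x hx hxD
    have hNf : (N x).Finite := hx.subset fun y hy => ⟨hy.2.2.1, hy.2.2.2⟩
    have hex : ∀ y, ∃ K, y ∈ N x → code Y K y ≠ code Y K x ∧ (r y < r x → lev K y < lev K x) := by
      intro y
      by_cases hy : y ∈ N x
      swap
      · exact ⟨0, fun h => absurd h hy⟩
      obtain ⟨K₁, hK₁⟩ := exists_code_ne hy.2.1
      by_cases hlt : r y < r x
      · have hlt' : (r y : ℝ) < r x := hlt
        obtain ⟨j, h1, h2⟩ := hq.exists_mem_open isOpen_Ioo (nonempty_Ioo.2 hlt')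
        refine ⟨max K₁ (j + 1), fun _ => ⟨fun hc => hK₁ (code_eq_of_le (le_max_left _ _) hc),
          fun _ => level_lt (Nat.lt_of_succ_le (le_max_right _ _)) h1.le h2⟩⟩
      · exact ⟨K₁, fun _ => ⟨hK₁, fun h => absurd h hlt⟩⟩
    choose K hK using hex
    refine ⟨hNf.toFinset.sup K, hxD, fun y hy => ?_⟩
    have hle : K y ≤ hNf.toFinset.sup K := Finset.le_sup (hNf.mem_toFinset.2 hy)
    exact ⟨fun hc => (hK y hy).1 (code_eq_of_le hle hc),
      fun hlt => hlevmono hle hlt.le ((hK y hy).2 hlt)⟩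
  · intro K
    let B : Set (Y × Y × Y) := {p | p.2.1 ∈ D ∧ p.2.1 ≠ p.1 ∧ r p.2.1 ≤ r p.1 ∧
      (p.2.2 ∈ G (r p.2.1) p.2.1 ∧ p.2.2 ∈ G (r p.1) p.1) ∧
      (code Y K p.2.1 = code Y K p.1 ∨ (r p.2.1 < r p.1 ∧ lev K p.1 ≤ lev K p.2.1))}
    have hm1 : Measurable fun p : Y × Y × Y => p.2.1 := measurable_fst.comp measurable_snd
    have hm2 : Measurable fun p : Y × Y × Y => p.2.2 := measurable_snd.comp measurable_snd
    have hm0 : Measurable fun p : Y × Y × Y => p.1 := measurable_fst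
    have hr0 : Measurable fun p : Y × Y × Y => r p.1 := hr.comp hm0
    have hr1 : Measurable fun p : Y × Y × Y => r p.2.1 := hr.comp hm1
    have hB : MeasurableSet B := by
      refine (hD.preimage hm1).inter ((measurableSet_eq_fun hm1 hm0).compl.inter
        ((measurableSet_le hr1 hr0).inter ((MeasurableSet.inter ?_ ?_).inter
        (MeasurableSet.union ?_ ((measurableSet_lt hr1 hr0).inter ?_)))))
      · exact (hG.measurableSet_comp hr).preimage (hm1.prodMk hm2)
      · exact (hG.measurableSet_comp hr).preimage (hm0.prodMk hm2)
      · exact measurableSet_eq_fun ((measurable_code K).comp hm1) ((measurable_code K).comp hm0)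
      · exact measurableSet_le ((hlev K).comp hm0) ((hlev K).comp hm1)
    -- Failure at resolution `K` is witnessed by a neighbour `y` and a common point `z`, so the bad
    -- set is a projection of a Borel set.
    have : E K = D \ (Prod.fst '' B) := by
      ext x
      refine and_congr_right fun hxD => ?_
      constructor
      · rintro h ⟨⟨x, y, z⟩, ⟨h1, h2, h3, h4, h5⟩, rfl⟩
        obtain ⟨h6, h7⟩ := h y ⟨h1, h2, h3, z, h4⟩
        rcases h5 with h5 | h5
        · exact h6 h5
        · exact (h7 h5.1).not_ge h5.2
      · rintro h y ⟨h1, h2, h3, z, h4⟩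
        constructor
        · exact fun hc => h ⟨(x, y, z), ⟨h1, h2, h3, h4, Or.inl hc⟩, rfl⟩
        · intro hlt
          by_contra hc
          exact h ⟨(x, y, z), ⟨h1, h2, h3, h4, Or.inr ⟨hlt, not_lt.1 hc⟩⟩, rfl⟩
    rw [this]
    exact hD.nullMeasurableSet.diff (nullMeasurableSet_image ν measurable_fst hB)
  · intro K
    have h1 : Measurable fun c : Fin K → Bool => (e K c : ℕ) := measurable_of_countable _
    have h2 : Measurable fun l : ℕ => m K * (K - l) := measurable_from_nat
    exact (h1.comp (measurable_code K)).add (h2.comp (hlev K))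
  · intro K x
    exact Nat.add_lt_add_of_lt_of_le (e K (code Y K x)).2
      (Nat.mul_le_mul_left _ (Nat.sub_le _ _))
  · have key : ∀ K, ∀ x ∈ E K, ∀ y ∈ E K, x ≠ y → (G (r x) x ∩ G (r y) y).Nonempty →
        r y ≤ r x → ρ K x ≠ ρ K y := by
      intro K x hx y hy hne hxy hle heq
      have h1 := (hx.2 y ⟨hy.1, hne.symm, hle, by rwa [inter_comm]⟩).1
      have h2 : (e K (code Y K x) : ℕ) = e K (code Y K y) := by rw [← hmod, ← hmod, heq]
      exact h1 ((e K).injective (Fin.ext h2)).symm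
    intro K x hx y hy hne hxy
    rcases le_total (r y) (r x) with h | h
    · exact key K x hx y hy hne hxy h
    · exact (key K y hy x hx hne.symm (by rwa [inter_comm]) h).symm
  · intro K x hx y hy hxy hlt
    by_contra! hc
    have hne : y ≠ x := fun h => (h ▸ hc).ne rfl
    have := (hx.2 y ⟨hy.1, hne, hc.le, by rwa [inter_comm]⟩).2 hc
    exact (hρlt this).not_gt hlt

/-- Covering with weight 1. Sets of equal rank are disjoint, so one rank loads each point at most
once; `a = 1` because a set with positive average is nonempty, and `b = C` because intersecting
points of larger rank have index at most `r y`. -/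
theorem IsAEFamily.weakType_of_regular (hS : IsDiscreteMP S ν) (hG : IsAEFamily S ν G)
    (hI : MeasurableSet I) (hIn : ∀ n : ℕ, ∃ r : I, (n : ℝ) ≤ r) {C : ℝ≥0}
    (hreg : ∀ᵐ x ∂ν, ∀ r, card {y | ∃ s ≤ r, (G s y ∩ G r x).Nonempty} ≤ C * card (G r x))
    {f : Y → ℝ≥0∞} (hf : Measurable f) (t : ℝ≥0∞) :
    t * ν {x | t < ⨆ r, avg f (G r x)} ≤ (1 + C) * 2 * ∫⁻ z, f z ∂ν := by
  refine hG.mul_measure_le_of_selection hI hIn hf fun D r hD hr hrD => ?_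
  obtain ⟨g, hg, hcov⟩ := hG.exists_cover hI hIn
  obtain ⟨E, ρ, L, hEmono, hEex, hED, hE, hρ, hL, hne, hrank⟩ := hG.exists_rank hD hr (by
    filter_upwards [hreg, hG.finite_section] with x hx hfin
    refine finite_of_card_ne_top (ne_top_of_le_ne_top ?_ ((card_mono ?_).trans (hx (r x))))
    · exact ENNReal.mul_ne_top ENNReal.coe_ne_top (card_ne_top (hfin _))
    · exact fun y hy => ⟨r y, hy⟩)
  refine mul_measure_le_of_forall_nat hEmono hEex fun n => ?_
  -- `E n` is only null measurable, and is replaced by a Borel subset of the same measure.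
  obtain ⟨E', hE'E, hE', hEE'⟩ := (hE n).exists_measurable_subset_ae_eq
  rw [← measure_congr hEE']
  have := hS.covering (a := 1) (b := C) (w := fun _ => 1) (U := fun x => G (r x) x) (t := t)
    hE' (hρ n) (L := L n) (fun x _ => hL n x) (hG.measurableSet_comp hr)
    (fun x => hG.subset_cls _ _) measurable_const hg ?_ ?_ ?_ ?_ hf ?_
  · simpa using this
  · filter_upwards [hcov] with x hx _ using hx (r x)
  · refine Eventually.of_forall fun z i => ?_
    have h1 : load (fun _ => 1) (fun x => G (r x) x) (E' ∩ ρ n ⁻¹' {i}) z =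
        card {y | y ∈ E' ∩ ρ n ⁻¹' {i} ∧ z ∈ G (r y) y} := (card_eq_tsum _).symm
    rw [h1, card]
    have h2 : {y | y ∈ E' ∩ ρ n ⁻¹' {i} ∧ z ∈ G (r y) y}.encard ≤ 1 := by
      refine encard_le_one_iff.2 fun x y hx hy => ?_
      by_contra hxy
      exact hne n x (hE'E hx.1.1) y (hE'E hy.1.1) hxy ⟨z, hx.2, hy.2⟩ (hx.1.2.trans hy.1.2.symm)
    exact_mod_cast h2
  · filter_upwards [hrD] with x hx hxE
    simpa using one_le_card (nonempty_of_lt_avg (hx (hED n (hE'E hxE))))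
  · filter_upwards [hreg] with y hy hyE
    refine (card_mono ?_).trans (hy (r y))
    exact fun x hx => ⟨r x, hrank n x (hE'E hx.1) y (hE'E hyE) hx.2.2 hx.2.1, hx.2.2⟩
  · filter_upwards [hrD] with x hx hxE
    exact mul_card_le_of_lt_avg (hx (hED n (hE'E hxE)))

/-- Temperedness controls only strictly smaller indices, so points of equal index must share a rank.
The weight `1 / b_r` compensates: at most `b_r` sets of index `r` contain a given point, so one rank
loads it by at most 1. Uniformity gives `a = C`. -/
theorem IsAEFamily.weakType_of_tempered (hS : IsDiscreteMP S ν) (hG : IsAEFamily S ν G)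
    (hI : I = posInts) (hIm : MeasurableSet I) (hIn : ∀ n : ℕ, ∃ r : I, (n : ℝ) ≤ r)
    {C Ct : ℝ≥0} {b : I → ℝ≥0} (hb : ∀ r, 0 < b r)
    (hcard : ∀ᵐ x ∂ν, ∀ r, (b r : ℝ≥0∞) ≤ C * card (G r x))
    (hinv : ∀ᵐ z ∂ν, ∀ r, card {y | z ∈ G r y} ≤ b r)
    (htemp : ∀ᵐ x ∂ν, ∀ r, card {y | ∃ s < r, (G s y ∩ G r x).Nonempty} ≤ Ct * card (G r x))
    {f : Y → ℝ≥0∞} (hf : Measurable f) (t : ℝ≥0∞) :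
    t * ν {x | t < ⨆ r, avg f (G r x)} ≤ (C + Ct) * 2 * ∫⁻ z, f z ∂ν := by
  refine hG.mul_measure_le_of_selection hIm hIn hf fun D r hD hr hrD => ?_
  obtain ⟨g, hg, hcov⟩ := hG.exists_cover hIm hIn
  have hnat : ∀ s : I, ∃ n : ℕ, (s : ℝ) = n := by
    rintro ⟨s, hs⟩
    rw [hI] at hs
    obtain ⟨n, rfl⟩ := hs
    exact ⟨n, rfl⟩
  choose k hk using hnat
  have hkinj : Function.Injective k := fun s s' h => Subtype.ext (by rw [hk, hk, h])
  have : Countable I := hkinj.countable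
  have hklt : ∀ {s s'}, k s < k s' → s < s' := fun {s s'} h => by
    change (s : ℝ) < s'
    rw [hk, hk]
    exact_mod_cast h
  have hkr : Measurable fun x => k (r x) := (measurable_of_countable k).comp hr
  let E : ℕ → Set Y := fun N => {x | x ∈ D ∧ k (r x) ≤ N}
  have hE : ∀ N, MeasurableSet (E N) := fun N =>
    hD.inter (measurableSet_le hkr measurable_const)
  refine mul_measure_le_of_forall_nat (E := E) (fun M N h x hx => ⟨hx.1, hx.2.trans h⟩)
    (Eventually.of_forall fun x hx => ⟨k (r x), hx, le_rfl⟩) fun N => ?_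
  -- The rank reverses the index. On `E N` the truncated subtraction is genuine, so equal ranks mean
  -- equal indices.
  have hρ : Measurable fun x => N - k (r x) :=
    (measurable_from_nat (f := fun n => N - n)).comp hkr
  refine hS.covering (a := C) (b := Ct) (w := fun x => (b (r x) : ℝ≥0∞)⁻¹)
    (U := fun x => G (r x) x) (t := t) (hE N) hρ (L := N + 1) (fun x _ => by omega)
    (hG.measurableSet_comp hr) (fun x => hG.subset_cls _ _)
    ((measurable_of_countable fun s => (b s : ℝ≥0∞)⁻¹).comp hr) hg ?_ ?_ ?_ ?_ hf ?_
  · filter_upwards [hcov] with x hx _ using hx (r x)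
  · filter_upwards [hinv] with z hz i
    by_cases hex : ∃ y ∈ E N ∩ (fun x => N - k (r x)) ⁻¹' {i}, z ∈ G (r y) y
    · obtain ⟨y₀, hy₀, -⟩ := hex
      have h1 : ∀ y ∈ E N ∩ (fun x => N - k (r x)) ⁻¹' {i}, r y = r y₀ := fun y hy => by
        refine hkinj ?_
        have e1 : k (r y) ≤ N := hy.1.2
        have e2 : k (r y₀) ≤ N := hy₀.1.2
        have e3 : N - k (r y) = N - k (r y₀) := hy.2.trans hy₀.2.symm
        omega
      have hb0 : (b (r y₀) : ℝ≥0∞) ≠ 0 := by exact_mod_cast (hb _).ne'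
      calc load (fun x => (b (r x) : ℝ≥0∞)⁻¹) (fun x => G (r x) x)
            (E N ∩ (fun x => N - k (r x)) ⁻¹' {i}) z
          ≤ ∑' y, (b (r y₀) : ℝ≥0∞)⁻¹ * {y | z ∈ G (r y₀) y}.indicator 1 y := by
            refine ENNReal.tsum_le_tsum fun y => ?_
            by_cases hy : y ∈ {y | y ∈ E N ∩ (fun x => N - k (r x)) ⁻¹' {i} ∧ z ∈ G (r y) y}
            · have h2 : r y = r y₀ := h1 y hy.1
              have h3 : y ∈ {y | z ∈ G (r y₀) y} := h2 ▸ hy.2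
              rw [indicator_of_mem hy, indicator_of_mem h3, h2, Pi.one_apply, mul_one]
            · rw [indicator_of_notMem hy]
              exact zero_le
        _ = (b (r y₀) : ℝ≥0∞)⁻¹ * card {y | z ∈ G (r y₀) y} := by
            rw [ENNReal.tsum_mul_left, card_eq_tsum]
        _ ≤ (b (r y₀) : ℝ≥0∞)⁻¹ * b (r y₀) := mul_le_mul_right (hz _) _
        _ = 1 := ENNReal.inv_mul_cancel hb0 ENNReal.coe_ne_top
    · have h0 : load (fun x => (b (r x) : ℝ≥0∞)⁻¹) (fun x => G (r x) x)
          (E N ∩ (fun x => N - k (r x)) ⁻¹' {i}) z = 0 := by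
        refine ENNReal.tsum_eq_zero.2 fun y => ?_
        have : y ∉ {y | y ∈ E N ∩ (fun x => N - k (r x)) ⁻¹' {i} ∧ z ∈ G (r y) y} :=
          fun hy => hex ⟨y, hy⟩
        exact indicator_of_notMem this _
      rw [h0]
      exact zero_le
  · filter_upwards [hcard] with x hx _
    have hb0 : (b (r x) : ℝ≥0∞) ≠ 0 := by exact_mod_cast (hb _).ne'
    rw [mul_left_comm, ← ENNReal.inv_mul_cancel hb0 ENNReal.coe_ne_top]
    exact mul_le_mul_right (hx _) _
  · filter_upwards [htemp] with y hy hyE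
    refine (card_mono ?_).trans (hy (r y))
    intro x hx
    refine ⟨r x, hklt ?_, hx.2.2⟩
    have e1 : N - k (r y) < N - k (r x) := hx.2.1
    omega
  · filter_upwards [hrD] with x hx hxE
    exact mul_card_le_of_lt_avg (hx hxE.1)

end WeakType

/-! ### Truncation and interpolation -/

/-- Truncation improves a weak type `(1, 1)` inequality for averages. -/
theorem mul_measure_le_setLIntegral_of_weakType {Y ι : Type*} [MeasurableSpace Y] {ν : Measure Y}
    {G : ι → Y → Set Y} {K : ℝ≥0∞}
    (hK : ∀ f : Y → ℝ≥0∞, Measurable f → ∀ t : ℝ≥0∞,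
      t * ν {x | t < ⨆ r, avg f (G r x)} ≤ K * ∫⁻ z, f z ∂ν)
    {f : Y → ℝ≥0∞} (hf : Measurable f) (t : ℝ≥0∞) :
    t * ν {x | 2 * t < ⨆ r, avg f (G r x)} ≤ K * ∫⁻ z in {z | t < f z}, f z ∂ν := by
  have hm : MeasurableSet {z | t < f z} := measurableSet_lt measurable_const hf
  -- The part of `f` of height at most `t` contributes at most `t` to any average.
  have hle : ∀ V : Set Y, avg f V ≤ avg ({z | t < f z}.indicator f) V + t := by
    intro V
    have h1 : ∑' z, V.indicator f z ≤
        ∑' z, V.indicator ({z | t < f z}.indicator f) z + t * card V := by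
      rw [card_eq_tsum, ← ENNReal.tsum_mul_left, ← ENNReal.tsum_add]
      refine ENNReal.tsum_le_tsum fun z => ?_
      by_cases hz : z ∈ V
      · by_cases hzt : t < f z
        · simp [hz, hzt]
        · simpa [hz, hzt] using not_lt.1 hzt
      · simp [hz]
    calc avg f V ≤ (∑' z, V.indicator ({z | t < f z}.indicator f) z + t * card V) / card V :=
          ENNReal.div_le_div_right h1 _
      _ ≤ _ := by
        rw [ENNReal.add_div]
        exact add_le_add le_rfl (ENNReal.div_le_of_le_mul le_rfl)
  rw [← lintegral_indicator hm]
  refine le_trans (mul_le_mul_right (measure_mono fun x hx => ?_) t) (hK _ (hf.indicator hm) t)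
  obtain ⟨r, hr⟩ := lt_iSup_iff.1 (show 2 * t < ⨆ r, avg f (G r x) from hx)
  change t < ⨆ r, avg ({z | t < f z}.indicator f) (G r x)
  refine lt_iSup_iff.2 ⟨r, ?_⟩
  have h2 := hr.trans_le (hle _)
  rw [two_mul] at h2
  exact lt_of_add_lt_add_right h2

section Interpolation

variable {Y : Type*} [MeasurableSpace Y] {ν : Measure Y} {g : Y → ℝ≥0∞} {u : Y → ℝ} {K : ℝ≥0}

/-- The right side of the weak inequality stays below `K * ∫ u` as `s` grows. Finiteness a.e.
permits real-valued layer-cake formulas for `g`. -/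
theorem ae_ne_top_of_weakType (hu : ∫⁻ x, ENNReal.ofReal (u x) ∂ν ≠ ∞)
    (hw : ∀ s : ℝ, 0 < s → ENNReal.ofReal s * ν {x | ENNReal.ofReal (2 * s) < g x} ≤
      K * ν.withDensity (fun x => ENNReal.ofReal (u x)) {x | s < u x}) :
    ∀ᵐ x ∂ν, g x ≠ ∞ := by
  rw [ae_iff]
  simp only [not_not]
  by_contra h0
  have hB : K * ν.withDensity (fun x => ENNReal.ofReal (u x)) univ ≠ ∞ := by
    rw [withDensity_apply _ MeasurableSet.univ, setLIntegral_univ]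
    exact ENNReal.mul_ne_top ENNReal.coe_ne_top hu
  obtain ⟨n, hn⟩ := ENNReal.exists_nat_mul_gt h0 hB
  refine hn.not_ge ?_
  calc (n : ℝ≥0∞) * ν {x | g x = ∞}
      ≤ ENNReal.ofReal (n + 1) * ν {x | ENNReal.ofReal (2 * (n + 1)) < g x} := by
        gcongr
        · rw [← ENNReal.ofReal_natCast]
          exact ENNReal.ofReal_le_ofReal (by linarith)
        · intro hx
          exact hx ▸ ENNReal.ofReal_lt_top
    _ ≤ K * ν.withDensity (fun x => ENNReal.ofReal (u x)) {x | (n + 1 : ℝ) < u x} :=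
        hw _ (by positivity)
    _ ≤ _ := by
        gcongr
        exact subset_univ _

/-- The weak inequality at level `s / 2`, so that `s` can serve as the layer-cake variable on both
sides. -/
theorem measure_lt_toReal_mul_le
    (hw : ∀ s : ℝ, 0 < s → ENNReal.ofReal s * ν {x | ENNReal.ofReal (2 * s) < g x} ≤
      K * ν.withDensity (fun x => ENNReal.ofReal (u x)) {x | s < u x}) {s : ℝ} (hs : 0 < s) :
    ENNReal.ofReal s * ν {x | s < (g x).toReal} ≤
      2 * K * ν.withDensity (fun x => ENNReal.ofReal (u x)) {x | s < 2 * u x} := by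
  have h1 : {x | s < (g x).toReal} ⊆ {x | ENNReal.ofReal (2 * (s / 2)) < g x} := by
    intro x hx
    change _ < g x
    rw [mul_div_cancel₀ _ two_ne_zero]
    exact (ENNReal.ofReal_lt_iff_lt_toReal hs.le
      (fun h => by simp [h] at hx; exact absurd hx hs.not_gt)).2 hx
  have h2 : {x | s / 2 < u x} = {x | s < 2 * u x} := by
    ext x
    exact div_lt_iff₀' (two_pos : (0 : ℝ) < 2)
  have h3 := hw (s / 2) (half_pos hs)
  rw [h2] at h3
  calc ENNReal.ofReal s * ν {x | s < (g x).toReal}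
      ≤ ENNReal.ofReal (2 * (s / 2)) * ν {x | ENNReal.ofReal (2 * (s / 2)) < g x} := by
        gcongr
        rw [mul_div_cancel₀ _ two_ne_zero]
    _ = 2 * (ENNReal.ofReal (s / 2) * ν {x | ENNReal.ofReal (2 * (s / 2)) < g x}) := by
        rw [ENNReal.ofReal_mul two_pos.le, mul_assoc]
        norm_num
    _ ≤ 2 * (K * ν.withDensity (fun x => ENNReal.ofReal (u x)) {x | s < 2 * u x}) := by gcongr
    _ = _ := (mul_assoc _ _ _).symm

/-- The Marcinkiewicz interpolation theorem between weak type `(1, 1)` and `L^∞`. -/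
theorem lintegral_rpow_le_of_weakType (hg : AEMeasurable g ν) (hum : Measurable u)
    (hu0 : ∀ x, 0 ≤ u x) (hu : ∫⁻ x, ENNReal.ofReal (u x) ∂ν ≠ ∞)
    (hw : ∀ s : ℝ, 0 < s → ENNReal.ofReal s * ν {x | ENNReal.ofReal (2 * s) < g x} ≤
      K * ν.withDensity (fun x => ENNReal.ofReal (u x)) {x | s < u x})
    {p : ℝ} (hp : 1 < p) :
    ∫⁻ x, g x ^ p ∂ν ≤ ENNReal.ofReal p * (2 * K * (ENNReal.ofReal (p - 1))⁻¹ *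
      ENNReal.ofReal (2 ^ (p - 1))) * ∫⁻ x, ENNReal.ofReal (u x) ^ p ∂ν := by
  have hp0 : 0 < p := one_pos.trans hp
  have hp1 : 0 < p - 1 := sub_pos.2 hp
  -- With the density `u` absorbed into `κ`, the bound becomes the layer-cake formula for `∫
  -- (2u)^(p-1) dκ = 2^(p-1) ∫ u^p dν`.
  set κ := ν.withDensity (fun x => ENNReal.ofReal (u x))
  have hum' : Measurable fun x => 2 * u x := hum.const_mul 2
  have hκ := lintegral_rpow_eq_lintegral_meas_lt_mul κ (f := fun x => 2 * u x)
    (Eventually.of_forall fun x => mul_nonneg two_pos.le (hu0 x)) hum'.aemeasurable hp1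
  have hκ' : ∫⁻ x, ENNReal.ofReal ((2 * u x) ^ (p - 1)) ∂κ =
      ENNReal.ofReal (2 ^ (p - 1)) * ∫⁻ x, ENNReal.ofReal (u x) ^ p ∂ν := by
    rw [lintegral_withDensity_eq_lintegral_mul _ hum.ennreal_ofReal
      (hum'.pow_const _).ennreal_ofReal, ← lintegral_const_mul' _ _ ENNReal.ofReal_ne_top]
    refine lintegral_congr fun x => ?_
    rw [Pi.mul_apply, ← ENNReal.ofReal_mul (hu0 x), ENNReal.ofReal_rpow_of_nonneg (hu0 x) hp0.le,
      ← ENNReal.ofReal_mul (by positivity), Real.mul_rpow two_pos.le (hu0 x)]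
    congr 1
    rcases (hu0 x).eq_or_lt with h | h
    · rw [← h, Real.zero_rpow hp0.ne', zero_mul, mul_zero]
    · rw [Real.rpow_sub_one h.ne' p]
      field_simp
  have hfin := ae_ne_top_of_weakType hu hw
  calc ∫⁻ x, g x ^ p ∂ν = ∫⁻ x, ENNReal.ofReal ((g x).toReal ^ p) ∂ν := by
        refine lintegral_congr_ae ?_
        filter_upwards [hfin] with x hx
        rw [← ENNReal.ofReal_rpow_of_nonneg ENNReal.toReal_nonneg hp0.le, ENNReal.ofReal_toReal hx]
    _ = ENNReal.ofReal p * ∫⁻ s in Ioi (0 : ℝ), ν {x | s < (g x).toReal} *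
          ENNReal.ofReal (s ^ (p - 1)) :=
        lintegral_rpow_eq_lintegral_meas_lt_mul ν
          (Eventually.of_forall fun x => ENNReal.toReal_nonneg) hg.ennreal_toReal hp0
    _ ≤ ENNReal.ofReal p * ∫⁻ s in Ioi (0 : ℝ), 2 * K * (κ {x | s < 2 * u x} *
          ENNReal.ofReal (s ^ (p - 1 - 1))) := by
        refine mul_le_mul_right (setLIntegral_mono' measurableSet_Ioi fun s hs => ?_) _
        have hs' : (0 : ℝ) < s := hs
        have h1 : s ^ (p - 1) = s * s ^ (p - 1 - 1) := by
          rw [Real.rpow_sub_one hs'.ne' (p - 1)]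
          field_simp
        rw [h1, ENNReal.ofReal_mul hs'.le, ← mul_assoc, ← mul_assoc, mul_comm (ν _)]
        exact mul_le_mul_left (measure_lt_toReal_mul_le hw hs') _
    _ = ENNReal.ofReal p * (2 * K * ((ENNReal.ofReal (p - 1))⁻¹ *
          ∫⁻ x, ENNReal.ofReal ((2 * u x) ^ (p - 1)) ∂κ)) := by
        rw [hκ, ← mul_assoc (ENNReal.ofReal (p - 1))⁻¹, ENNReal.inv_mul_cancel
          (ENNReal.ofReal_pos.2 hp1).ne' ENNReal.ofReal_ne_top, one_mul,
          lintegral_const_mul' _ _ (ENNReal.mul_ne_top ENNReal.ofNat_ne_top ENNReal.coe_ne_top)]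
    _ = _ := by
        rw [hκ']
        ring

theorem integral_inv_one_add {x : ℝ} (hx : 0 ≤ x) :
    ∫ t in (0 : ℝ)..x, 1 / (1 + t) = Real.log (1 + x) := by
  have h : ∀ t ∈ uIcc 0 x, HasDerivAt (fun t => Real.log (1 + t)) (1 / (1 + t)) t := by
    intro t ht
    rw [uIcc_of_le hx] at ht
    have : (1 + t) ≠ 0 := by linarith [ht.1]
    exact ((hasDerivAt_id t).const_add 1).log this
  rw [intervalIntegral.integral_eq_sub_of_hasDerivAt h]
  · simp
  · refine ContinuousOn.intervalIntegrable fun t ht => ?_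
    rw [uIcc_of_le hx] at ht
    have : (1 + t) ≠ 0 := by linarith [ht.1]
    exact (continuousAt_const.div (continuousAt_const.add continuousAt_id) this).continuousWithinAt

theorem le_three_add_mul_posLog {x : ℝ} (hx : 0 ≤ x) : x ≤ 3 + x * Real.posLog x := by
  rcases le_total x 3 with h | h
  · linarith [mul_nonneg hx (Real.posLog_nonneg (x := x))]
  · have h1 : 1 ≤ Real.posLog x := by
      rw [Real.posLog_eq_log (by rw [abs_of_nonneg hx]; linarith),
        Real.le_log_iff_exp_le (by linarith)]
      exact (Real.exp_one_lt_d9.le.trans (by norm_num)).trans h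
    nlinarith

theorem mul_log_one_add_le {x : ℝ} (hx : 0 ≤ x) :
    x * Real.log (1 + 2 * x) ≤ 6 + 3 * (x * Real.posLog x) := by
  have h1 : Real.log (1 + 2 * x) ≤ 2 + Real.posLog x := by
    have h3 : Real.log 3 ≤ 2 := (Real.log_le_sub_one_of_pos three_pos).trans (by norm_num)
    rcases le_total x 1 with h | h
    · have : Real.log (1 + 2 * x) ≤ Real.log 3 := Real.log_le_log (by linarith) (by linarith)
      linarith [Real.posLog_nonneg (x := x)]
    · have : Real.log (1 + 2 * x) ≤ Real.log (3 * x) := Real.log_le_log (by linarith) (by linarith)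
      rw [Real.log_mul three_ne_zero (by linarith)] at this
      rw [Real.posLog_eq_log (by rw [abs_of_nonneg hx]; exact h)]
      linarith
  nlinarith [le_three_add_mul_posLog hx, mul_le_mul_of_nonneg_left h1 hx]

theorem lintegral_ofReal_ne_top_of_mul_posLog [IsFiniteMeasure ν] (hu0 : ∀ x, 0 ≤ u x)
    (hlog : ∫⁻ x, ENNReal.ofReal (u x * Real.posLog (u x)) ∂ν ≠ ∞) :
    ∫⁻ x, ENNReal.ofReal (u x) ∂ν ≠ ∞ := by
  have h1 : ∫⁻ x, ENNReal.ofReal (u x) ∂ν ≤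
      ∫⁻ x, (3 + ENNReal.ofReal (u x * Real.posLog (u x))) ∂ν := by
    refine lintegral_mono fun x => ?_
    refine (ENNReal.ofReal_le_ofReal (le_three_add_mul_posLog (hu0 x))).trans ?_
    refine ENNReal.ofReal_add_le.trans ?_
    simp
  refine ne_top_of_le_ne_top ?_ h1
  rw [lintegral_add_left measurable_const, lintegral_const]
  exact ENNReal.add_ne_top.2 ⟨ENNReal.mul_ne_top ENNReal.ofNat_ne_top (measure_ne_top _ _), hlog⟩

/-- The `L log L` endpoint of the Marcinkiewicz interpolation theorem. -/
theorem lintegral_le_of_weakType_of_mul_posLog [IsProbabilityMeasure ν] (hg : AEMeasurable g ν)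
    (hum : Measurable u) (hu0 : ∀ x, 0 ≤ u x)
    (hlog : ∫⁻ x, ENNReal.ofReal (u x * Real.posLog (u x)) ∂ν ≤ 1)
    (hw : ∀ s : ℝ, 0 < s → ENNReal.ofReal s * ν {x | ENNReal.ofReal (2 * s) < g x} ≤
      K * ν.withDensity (fun x => ENNReal.ofReal (u x)) {x | s < u x}) :
    ∫⁻ x, g x ∂ν ≤ 1 + 36 * K := by
  set κ := ν.withDensity (fun x => ENNReal.ofReal (u x))
  have hum' : Measurable fun x => 2 * u x := hum.const_mul 2
  -- The kernel `1 / (1 + t)` replaces `1 / t`: it is integrable at 0 and has primitive `log (1 +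
  -- t)`.
  have hκ := lintegral_comp_eq_lintegral_meas_lt_mul κ (f := fun x => 2 * u x)
    (g := fun t => 1 / (1 + t))
    (Eventually.of_forall fun x => mul_nonneg two_pos.le (hu0 x)) hum'.aemeasurable
    (fun t ht => by
      refine ContinuousOn.intervalIntegrable fun s hs => ?_
      rw [uIcc_of_le ht.le] at hs
      have : (1 + s) ≠ 0 := by linarith [hs.1]
      exact (continuousAt_const.div (continuousAt_const.add continuousAt_id)
        this).continuousWithinAt)
    (by
      filter_upwards [ae_restrict_mem measurableSet_Ioi] with t ht
      have ht' : (0 : ℝ) < t := ht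
      positivity)
  have hκ' : ∫⁻ x, ENNReal.ofReal (∫ t in (0 : ℝ)..2 * u x, 1 / (1 + t)) ∂κ ≤ 9 := by
    have h0 : ∀ x, ENNReal.ofReal (∫ t in (0 : ℝ)..2 * u x, 1 / (1 + t)) =
        ENNReal.ofReal (Real.log (1 + 2 * u x)) := fun x => by
      rw [integral_inv_one_add (mul_nonneg two_pos.le (hu0 x))]
    simp only [h0]
    rw [lintegral_withDensity_eq_lintegral_mul _ hum.ennreal_ofReal
      (show Measurable fun x => ENNReal.ofReal (Real.log (1 + 2 * u x)) from
        (Real.measurable_log.comp (hum'.const_add 1)).ennreal_ofReal)]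
    calc ∫⁻ x, ((fun x => ENNReal.ofReal (u x)) *
          fun x => ENNReal.ofReal (Real.log (1 + 2 * u x))) x ∂ν
        ≤ ∫⁻ x, (6 + 3 * ENNReal.ofReal (u x * Real.posLog (u x))) ∂ν := by
          refine lintegral_mono fun x => ?_
          rw [Pi.mul_apply, ← ENNReal.ofReal_mul (hu0 x)]
          refine (ENNReal.ofReal_le_ofReal (mul_log_one_add_le (hu0 x))).trans ?_
          refine ENNReal.ofReal_add_le.trans ?_
          rw [ENNReal.ofReal_mul (by norm_num : (0 : ℝ) ≤ 3)]
          simp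
      _ = 6 + 3 * ∫⁻ x, ENNReal.ofReal (u x * Real.posLog (u x)) ∂ν := by
          rw [lintegral_add_left measurable_const, lintegral_const, measure_univ, mul_one,
            lintegral_const_mul' _ _ ENNReal.ofNat_ne_top]
      _ ≤ 6 + 3 * 1 := by gcongr
      _ = 9 := by norm_num
  have hfin := ae_ne_top_of_weakType (lintegral_ofReal_ne_top_of_mul_posLog hu0
    (ne_top_of_le_ne_top ENNReal.one_ne_top hlog)) hw
  have h4 : (2 * 2 * K : ℝ≥0∞) ≠ ∞ :=
    ENNReal.mul_ne_top (by norm_num) ENNReal.coe_ne_top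
  calc ∫⁻ x, g x ∂ν = ∫⁻ x, ENNReal.ofReal (g x).toReal ∂ν := by
        refine lintegral_congr_ae ?_
        filter_upwards [hfin] with x hx
        rw [ENNReal.ofReal_toReal hx]
    _ = ∫⁻ s in Ioi (0 : ℝ), ν {x | s < (g x).toReal} :=
        lintegral_eq_lintegral_meas_lt ν
          (Eventually.of_forall fun x => ENNReal.toReal_nonneg) hg.ennreal_toReal
    -- Levels up to 1 contribute at most 1, as `ν` is a probability measure. Above 1 the weak
    -- inequality is used with `1 / s ≤ 2 / (1 + s)`.
    _ ≤ ∫⁻ s in Ioi (0 : ℝ), ((Ioc (0 : ℝ) 1).indicator 1 s + 2 * 2 * K *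
          (κ {x | s < 2 * u x} * ENNReal.ofReal (1 / (1 + s)))) := by
        refine setLIntegral_mono' measurableSet_Ioi fun s hs => ?_
        have hs' : (0 : ℝ) < s := hs
        rcases le_or_gt s 1 with h1 | h1
        · rw [indicator_of_mem (show s ∈ Ioc (0 : ℝ) 1 from ⟨hs', h1⟩)]
          exact le_add_right prob_le_one
        · refine le_add_left ?_
          have h2 := measure_lt_toReal_mul_le hw hs'
          have h3 : (1 : ℝ≥0∞) ≤ 2 * (ENNReal.ofReal (1 / (1 + s)) * ENNReal.ofReal s) := by
            rw [← ENNReal.ofReal_mul (by positivity), ← ENNReal.ofReal_ofNat,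
              ← ENNReal.ofReal_mul (by norm_num), ← ENNReal.ofReal_one]
            refine ENNReal.ofReal_le_ofReal ?_
            rw [one_div, ← div_eq_inv_mul, mul_div_assoc', le_div_iff₀ (by linarith)]
            linarith
          calc ν {x | s < (g x).toReal}
              ≤ 2 * (ENNReal.ofReal (1 / (1 + s)) * ENNReal.ofReal s) *
                ν {x | s < (g x).toReal} := le_mul_of_one_le_left zero_le h3
            _ = 2 * ENNReal.ofReal (1 / (1 + s)) *
                (ENNReal.ofReal s * ν {x | s < (g x).toReal}) := by ring
            _ ≤ 2 * ENNReal.ofReal (1 / (1 + s)) * (2 * K * κ {x | s < 2 * u x}) := by gcongr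
            _ = _ := by ring
    _ ≤ 1 + 2 * 2 * K * 9 := by
        rw [lintegral_add_left (measurable_one.indicator measurableSet_Ioc),
          lintegral_const_mul' _ _ h4, ← hκ]
        gcongr
        rw [lintegral_indicator_one measurableSet_Ioc, Measure.restrict_apply measurableSet_Ioc]
        refine (measure_mono inter_subset_left).trans ?_
        simp
    _ = 1 + 36 * K := by ring

end Interpolation

/-! ### Lifting the hypotheses to class-bijective extensions -/

theorem card_le_card_of_injOn {X Y : Type*} {π : Y → X} {V : Set Y} {W : Set X}
    (hV : InjOn π V) (h : MapsTo π V W) : card V ≤ card W := by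
  have h1 : V.encard ≤ W.encard := hV.encard_image ▸ encard_le_encard h.image_subset
  rw [card, card]
  exact_mod_cast h1

/-- Sharing a point forces `y'` into the class of `y`, where `π` is injective. The predicate `p`
covers both `s ≤ r` (regular) and `s < r` (tempered). -/
theorem card_related_lift_le {X : Type u} {R : Setoid X} {I : Set ℝ} {F : I → X → Set X}
    {Y : Type v} {S : Setoid Y} {π : Y → X} {y : Y}
    (hy : BijOn π (cls S y) (cls R (π y))) (p : I → Prop) (r : I) :
    card {y' | ∃ s, p s ∧ (lift π S F s y' ∩ lift π S F r y).Nonempty} ≤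
      card (⋃ s, ⋃ (_ : p s), mul (inv (F s)) (F r) (π y)) := by
  refine card_le_card_of_injOn (hy.injOn.mono ?_) ?_
  · rintro y' ⟨s, -, z, hz, hz'⟩
    exact S.trans hz'.2 (S.symm hz.2)
  · rintro y' ⟨s, hs, z, hz, hz'⟩
    exact mem_iUnion₂.2 ⟨s, hs, mem_iUnion₂.2 ⟨π z, hz'.1, hz.1⟩⟩

theorem card_lift {X : Type u} [MeasurableSpace X] {R : Setoid X} {I : Set ℝ}
    {F : I → X → Set X} {Y : Type v} {S : Setoid Y} {π : Y → X} {y : Y} (hF : IsBorelFamily R F)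
    (hy : BijOn π (cls S y) (cls R (π y))) (r : I) :
    card (lift π S F r y) = card (F r (π y)) := by
  have himg : π '' lift π S F r y = F r (π y) := by
    rw [lift, image_preimage_inter, hy.image_eq]
    exact inter_eq_left.2 (hF.subset_cls r _)
  have hinj : InjOn π (lift π S F r y) := hy.injOn.mono inter_subset_right
  rw [card, card, ← himg, hinj.encard_image]

section Lift

variable {X : Type u} [MeasurableSpace X] {μ : Measure X} {R : Setoid X} {I : Set ℝ}
  {F : I → X → Set X} {Y : Type v} [MeasurableSpace Y] {ν : Measure Y} {S : Setoid Y} {π : Y → X}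

theorem isAEFamily_lift (hF : IsBorelFamily R F)
    (h : IsClassBijectiveExtension π S ν R μ) : IsAEFamily S ν (lift π S F) where
  subset_cls _ _ := inter_subset_right
  measurableSet := by
    have hπ := h.measurePreserving.measurable
    have h1 : Measurable fun q : Y × Y × I => (π q.1, π q.2.1, q.2.2) := by fun_prop
    have h2 : Measurable fun q : Y × Y × I => (q.1, q.2.1) := by fun_prop
    exact (hF.measurableSet.preimage h1).inter (h.discreteMP.measurableSet.preimage h2)
  finite := by
    filter_upwards [h.bijOn] with y hy r
    refine Finite.of_injOn (f := π) (t := ⋃ s ≤ r, F s (π y)) ?_ (hy.injOn.mono ?_)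
      (hF.finite r (π y))
    · intro z hz
      obtain ⟨s, hs, hz⟩ := mem_iUnion₂.1 hz
      exact mem_iUnion₂.2 ⟨s, hs, hz.1⟩
    · exact iUnion₂_subset fun s _ => inter_subset_right

theorem measurableSet_of_eq_posInts_or {I : Set ℝ} (hI : I = posInts ∨ I = Ioi 0) :
    MeasurableSet I := by
  rcases hI with rfl | rfl
  · exact (countable_range _).measurableSet
  · exact measurableSet_Ioi

theorem exists_nat_le_of_eq_posInts_or {I : Set ℝ} (hI : I = posInts ∨ I = Ioi 0) (n : ℕ) :
    ∃ r : I, (n : ℝ) ≤ r := by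
  have hmem : ((n + 1 : ℕ) : ℝ) ∈ I := by
    rcases hI with rfl | rfl
    · exact ⟨n.succPNat, rfl⟩
    · exact mem_Ioi.2 (Nat.cast_pos.2 n.succ_pos)
  exact ⟨⟨_, hmem⟩, Nat.cast_le.2 n.le_succ⟩

/-- The weak type `(1, 1)` maximal inequality, uniformly over all class-bijective extensions. -/
theorem exists_weakType_lift (hI : I = posInts ∨ I = Ioi 0) (hF : IsBorelFamily R F)
    (h : Regular μ F ∨ (Uniform μ F ∧ Tempered μ F)) :
    ∃ K : ℝ≥0, ∀ (Y : Type v) [MeasurableSpace Y] [StandardBorelSpace Y] (ν : Measure Y)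
      [IsProbabilityMeasure ν] (S : Setoid Y) (π : Y → X),
      IsClassBijectiveExtension π S ν R μ → ∀ f : Y → ℝ≥0∞, Measurable f → ∀ t : ℝ≥0∞,
        t * ν {x | t < ⨆ r, avg f (lift π S F r x)} ≤ K * ∫⁻ z, f z ∂ν := by
  have hIm := measurableSet_of_eq_posInts_or hI
  have hIn := exists_nat_le_of_eq_posInts_or hI
  rcases h with ⟨C, -, hreg⟩ | ⟨⟨C, a, b, -, hab⟩, hIp, Ct, htemp⟩
  · refine ⟨(1 + C) * 2, fun Y _ _ ν _ S π hext f hf t => ?_⟩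
    have := (isAEFamily_lift hF hext).weakType_of_regular hext.discreteMP hIm hIn (C := C) ?_ hf t
    · simpa using this
    · filter_upwards [hext.measurePreserving.quasiMeasurePreserving.ae hreg, hext.bijOn]
        with y hy hbij r
      rw [card_lift hF hbij]
      exact (card_related_lift_le hbij (· ≤ r) r).trans (hy r)
  · have : Countable I := by
      rw [hIp]
      exact countable_range _
    refine ⟨(C + Ct) * 2, fun Y _ _ ν _ S π hext f hf t => ?_⟩
    have hqmp := hext.measurePreserving.quasiMeasurePreserving
    have hcard := hqmp.ae (ae_all_iff.2 fun r => (hab r).2.2.2.1)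
    have hinv := hqmp.ae (ae_all_iff.2 fun r => (hab r).2.2.2.2)
    have := (isAEFamily_lift hF hext).weakType_of_tempered hext.discreteMP hIp hIm hIn (C := C)
      (Ct := Ct) (b := b) (fun r => (hab r).2.1) ?_ ?_ ?_ hf t
    · simpa using this
    · filter_upwards [hcard, hext.bijOn] with y hy hbij r
      rw [card_lift hF hbij]
      have h1 : (b r : ℝ≥0∞) ≤ C * a r := by exact_mod_cast (hab r).2.2.1
      exact h1.trans (mul_le_mul_right (hy r).1 _)
    · filter_upwards [hinv, hext.bijOn] with y hy hbij r
      refine le_trans (card_le_card_of_injOn (hbij.injOn.mono ?_) ?_) (hy r).2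
      · exact fun z hz => S.symm hz.2
      · exact fun z hz => hz.1
    · filter_upwards [hqmp.ae htemp, hext.bijOn] with y hy hbij r
      rw [card_lift hF hbij]
      exact (card_related_lift_le hbij (· < r) r).trans (hy r)

end Lift

/-! ### Strong type bounds for the maximal function -/

/-- Almost every class avoids the null set where `‖f‖ₑ` and `f'` differ, so all averages agree at
once. -/
theorem maximal_ae_eq {Y : Type v} [MeasurableSpace Y] [StandardBorelSpace Y] {ν : Measure Y}
    [IsFiniteMeasure ν] {S : Setoid Y} (hS : IsDiscreteMP S ν) {I : Set ℝ} {G : I → Y → Set Y}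
    (hG : ∀ r x, G r x ⊆ cls S x) {𝕜 : Type w} [RCLike 𝕜] {f : Y → 𝕜} {f' : Y → ℝ≥0∞}
    (hf : ∀ᵐ x ∂ν, ‖f x‖ₑ = f' x) :
    ∀ᵐ x ∂ν, maximal G f x = ⨆ r, avg f' (G r x) := by
  filter_upwards [hS.ae_forall_rel hf] with x hx
  refine iSup_congr fun r => ?_
  rw [absAvg, avg, ← tsum_subtype]
  congr 1
  exact tsum_congr fun z => hx z (hG r x z.2)

theorem avg_const_mul {Y : Type*} (c : ℝ≥0∞) (f : Y → ℝ≥0∞) (V : Set Y) :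
    avg (fun x => c * f x) V = c * avg f V := by
  rw [avg, avg, ← mul_div_assoc, ← ENNReal.tsum_mul_left]
  congr 1
  refine tsum_congr fun z => ?_
  by_cases hz : z ∈ V <;> simp [hz]

theorem avg_le_of_forall_le {Y : Type*} {f : Y → ℝ≥0∞} {V : Set Y} {c : ℝ≥0∞}
    (h : ∀ z ∈ V, f z ≤ c) : avg f V ≤ c := by
  refine ENNReal.div_le_of_le_mul ?_
  rw [card_eq_tsum, ← ENNReal.tsum_mul_left]
  refine ENNReal.tsum_le_tsum fun z => ?_
  by_cases hz : z ∈ V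
  · simpa [hz] using h z hz
  · simp [hz]

theorem exists_measurable_norm_rep {Y : Type*} [MeasurableSpace Y] {ν : Measure Y} {𝕜 : Type*}
    [RCLike 𝕜] {f : Y → 𝕜} (hf : AEStronglyMeasurable f ν) :
    ∃ u : Y → ℝ, Measurable u ∧ (∀ x, 0 ≤ u x) ∧ ∀ᵐ x ∂ν, ‖f x‖ = u x :=
  ⟨fun x => ‖hf.mk f x‖, hf.stronglyMeasurable_mk.norm.measurable, fun _ => norm_nonneg _,
    hf.ae_eq_mk.fun_comp (‖·‖)⟩

theorem truncated_weakType {Y : Type*} [MeasurableSpace Y] {ν : Measure Y} {I : Set ℝ}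
    {G : I → Y → Set Y} {K : ℝ≥0}
    (hK : ∀ f : Y → ℝ≥0∞, Measurable f → ∀ t : ℝ≥0∞,
      t * ν {x | t < ⨆ r, avg f (G r x)} ≤ K * ∫⁻ z, f z ∂ν) {u : Y → ℝ} (hu : Measurable u)
    (s : ℝ) (hs : 0 < s) :
    ENNReal.ofReal s * ν {x | ENNReal.ofReal (2 * s) <
        ⨆ r, avg (fun x => ENNReal.ofReal (u x)) (G r x)} ≤
      K * ν.withDensity (fun x => ENNReal.ofReal (u x)) {x | s < u x} := by
  have h := mul_measure_le_setLIntegral_of_weakType hK hu.ennreal_ofReal (ENNReal.ofReal s)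
  simp only [ENNReal.ofReal_lt_ofReal_iff_of_nonneg hs.le] at h
  rw [withDensity_apply _ (measurableSet_lt measurable_const hu),
    ENNReal.ofReal_mul two_pos.le, ENNReal.ofReal_ofNat]
  exact h

section StrongType

variable {Y : Type v} [MeasurableSpace Y] [StandardBorelSpace Y] {ν : Measure Y}
  {S : Setoid Y} {I : Set ℝ} {G : I → Y → Set Y} {K : ℝ≥0} {𝕜 : Type w} [RCLike 𝕜] {f : Y → 𝕜}

theorem eLpNorm_top_maximal_le [IsFiniteMeasure ν] (hS : IsDiscreteMP S ν)
    (hG : ∀ r x, G r x ⊆ cls S x) (f : Y → 𝕜) :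
    eLpNorm (maximal G f) ∞ ν ≤ eLpNorm f ∞ ν := by
  rw [eLpNorm_exponent_top, eLpNorm_exponent_top]
  refine essSup_le_of_ae_le _ ?_
  filter_upwards [maximal_ae_eq hS hG (f := f) (f' := fun x => ‖f x‖ₑ)
    (Eventually.of_forall fun _ => rfl),
    hS.ae_forall_rel (enorm_ae_le_eLpNormEssSup f ν)] with x hx hle
  rw [hx, enorm_eq_self]
  exact iSup_le fun r => avg_le_of_forall_le fun z hz => hle z (hG r x hz)

theorem eLpNorm_maximal_le [IsFiniteMeasure ν] (hS : IsDiscreteMP S ν) (hG : IsAEFamily S ν G)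
    (hI : MeasurableSet I) (hIn : ∀ n : ℕ, ∃ r : I, (n : ℝ) ≤ r)
    (hK : ∀ f : Y → ℝ≥0∞, Measurable f → ∀ t : ℝ≥0∞,
      t * ν {x | t < ⨆ r, avg f (G r x)} ≤ K * ∫⁻ z, f z ∂ν)
    {p : ℝ≥0∞} (hp : 1 < p) (hp' : p ≠ ∞) (hf : MemLp f p ν) :
    eLpNorm (maximal G f) p ν ≤ (ENNReal.ofReal p.toReal * (2 * K *
      (ENNReal.ofReal (p.toReal - 1))⁻¹ * ENNReal.ofReal (2 ^ (p.toReal - 1)))) ^ (1 / p.toReal) *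
        eLpNorm f p ν := by
  obtain ⟨u, hu, hu0, hfu⟩ := exists_measurable_norm_rep hf.aestronglyMeasurable
  have hfu' : ∀ᵐ x ∂ν, ‖f x‖ₑ = ENNReal.ofReal (u x) := by
    filter_upwards [hfu] with x hx
    rw [← hx, ofReal_norm]
  have hp0 : p ≠ 0 := (zero_lt_one.trans hp).ne'
  have hq : 1 < p.toReal := by
    rw [← ENNReal.toReal_one]
    exact (ENNReal.toReal_lt_toReal ENNReal.one_ne_top hp').2 hp
  rw [eLpNorm_eq_lintegral_rpow_enorm_toReal hp0 hp',
    eLpNorm_eq_lintegral_rpow_enorm_toReal hp0 hp',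
    ← ENNReal.mul_rpow_of_nonneg _ _ (by positivity)]
  refine ENNReal.rpow_le_rpow ?_ (by positivity)
  have h1 : ∫⁻ x, ‖maximal G f x‖ₑ ^ p.toReal ∂ν =
      ∫⁻ x, (⨆ r, avg (fun x => ENNReal.ofReal (u x)) (G r x)) ^ p.toReal ∂ν := by
    refine lintegral_congr_ae ?_
    filter_upwards [maximal_ae_eq hS hG.subset_cls hfu'] with x hx
    rw [enorm_eq_self, hx]
  have h2 : ∫⁻ x, ‖f x‖ₑ ^ p.toReal ∂ν = ∫⁻ x, ENNReal.ofReal (u x) ^ p.toReal ∂ν := by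
    refine lintegral_congr_ae ?_
    filter_upwards [hfu'] with x hx
    rw [hx]
  have h3 : ∫⁻ x, ENNReal.ofReal (u x) ∂ν ≠ ∞ := by
    rw [← lintegral_congr_ae hfu', ← eLpNorm_one_eq_lintegral_enorm]
    exact (hf.mono_exponent hp.le).eLpNorm_ne_top
  rw [h1, h2]
  exact lintegral_rpow_le_of_weakType (hG.aemeasurable_iSup_avg hI hIn hu.ennreal_ofReal) hu hu0 h3
    (truncated_weakType hK hu) hq

theorem eLpNorm_one_maximal_le [IsProbabilityMeasure ν] (hS : IsDiscreteMP S ν)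
    (hG : IsAEFamily S ν G) (hI : MeasurableSet I) (hIn : ∀ n : ℕ, ∃ r : I, (n : ℝ) ≤ r)
    (hK : ∀ f : Y → ℝ≥0∞, Measurable f → ∀ t : ℝ≥0∞,
      t * ν {x | t < ⨆ r, avg f (G r x)} ≤ K * ∫⁻ z, f z ∂ν)
    (hf : AEStronglyMeasurable f ν) :
    eLpNorm (maximal G f) 1 ν ≤ (1 + 36 * K) * llogNorm f ν := by
  obtain ⟨u, hu, hu0, hfu⟩ := exists_measurable_norm_rep hf
  have hK0 : (1 + 36 * K : ℝ≥0∞) ≠ 0 := by simp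
  have hKt : (1 + 36 * K : ℝ≥0∞) ≠ ∞ :=
    ENNReal.add_ne_top.2 ⟨ENNReal.one_ne_top,
      ENNReal.mul_ne_top ENNReal.ofNat_ne_top ENNReal.coe_ne_top⟩
  rw [← ENNReal.div_le_iff' hK0 hKt]
  -- By homogeneity it is enough to treat each admissible `c`: after division by `c` the `L log L`
  -- integral is at most 1.
  refine le_iInf fun c => le_iInf fun hc => le_iInf fun hlog => ?_
  rw [ENNReal.div_le_iff' hK0 hKt]
  have hc' : (0 : ℝ) < c := hc
  have hfu' : ∀ᵐ x ∂ν, ‖f x‖ₑ = c * ENNReal.ofReal (u x / c) := by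
    filter_upwards [hfu] with x hx
    rw [← ofReal_norm, hx, ← ENNReal.ofReal_coe_nnreal, ← ENNReal.ofReal_mul hc'.le,
      mul_div_cancel₀ _ hc'.ne']
  have hlog' : ∫⁻ x, ENNReal.ofReal (u x / c * Real.posLog (u x / c)) ∂ν ≤ 1 := by
    refine le_trans (lintegral_congr_ae ?_).le hlog
    filter_upwards [hfu] with x hx
    rw [hx]
  have hm : Measurable fun x => u x / c := hu.div_const _
  rw [eLpNorm_one_eq_lintegral_enorm]
  calc ∫⁻ x, ‖maximal G f x‖ₑ ∂ν
      = ∫⁻ x, c * ⨆ r, avg (fun x => ENNReal.ofReal (u x / c)) (G r x) ∂ν := by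
        refine lintegral_congr_ae ?_
        filter_upwards [maximal_ae_eq hS hG.subset_cls hfu'] with x hx
        simp only [enorm_eq_self, hx, avg_const_mul, ENNReal.mul_iSup]
    _ = c * ∫⁻ x, ⨆ r, avg (fun x => ENNReal.ofReal (u x / c)) (G r x) ∂ν :=
        lintegral_const_mul' _ _ ENNReal.coe_ne_top
    _ ≤ c * (1 + 36 * K) := by
        gcongr
        exact lintegral_le_of_weakType_of_mul_posLog
          (hG.aemeasurable_iSup_avg hI hIn hm.ennreal_ofReal) hm
          (fun x => div_nonneg (hu0 x) hc'.le)
          hlog' (truncated_weakType hK hm)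
    _ = (1 + 36 * K) * c := mul_comm _ _

theorem aemeasurable_maximal [IsFiniteMeasure ν] (hS : IsDiscreteMP S ν) (hG : IsAEFamily S ν G)
    (hI : MeasurableSet I) (hIn : ∀ n : ℕ, ∃ r : I, (n : ℝ) ≤ r)
    (hf : AEStronglyMeasurable f ν) : AEMeasurable (maximal G f) ν := by
  obtain ⟨u, hu, hu0, hfu⟩ := exists_measurable_norm_rep hf
  have hfu' : ∀ᵐ x ∂ν, ‖f x‖ₑ = ENNReal.ofReal (u x) := by
    filter_upwards [hfu] with x hx
    rw [← hx, ofReal_norm]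
  refine (hG.aemeasurable_iSup_avg hI hIn hu.ennreal_ofReal).congr ?_
  filter_upwards [maximal_ae_eq hS hG.subset_cls hfu'] with x hx
  exact hx.symm

end StrongType

end AmenableRel

theorem mainTheorem8 {𝕜 : Type w} [RCLike 𝕜]
    {X : Type u} [MeasurableSpace X] [StandardBorelSpace X]
    (μ : Measure X) [IsProbabilityMeasure μ]
    (R : Setoid X) (hR : AmenableRel.IsDiscreteMP R μ)
    (I : Set ℝ) (hI : I = AmenableRel.posInts ∨ I = Ioi 0)
    (F : I → X → Set X) (hF : AmenableRel.IsBorelFamily R F)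
    (h : AmenableRel.Regular μ F ∨
      (AmenableRel.AsymptoticallyInvariant R μ F ∧ AmenableRel.Uniform μ F ∧
        AmenableRel.Tempered μ F)) :
    (∀ p : ℝ≥0∞, 1 < p → ∃ C : ℝ≥0, 0 < C ∧
      ∀ (Y : Type v) [MeasurableSpace Y] [StandardBorelSpace Y]
        (ν : Measure Y) [IsProbabilityMeasure ν] (S : Setoid Y) (π : Y → X),
        AmenableRel.IsClassBijectiveExtension π S ν R μ →
        ∀ f : Y → 𝕜, MemLp f p ν →
          AEMeasurable (AmenableRel.maximal (AmenableRel.lift π S F) f) ν ∧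
          eLpNorm (AmenableRel.maximal (AmenableRel.lift π S F) f) p ν ≤ C * eLpNorm f p ν) ∧
    (∃ C : ℝ≥0, 0 < C ∧
      ∀ (Y : Type v) [MeasurableSpace Y] [StandardBorelSpace Y]
        (ν : Measure Y) [IsProbabilityMeasure ν] (S : Setoid Y) (π : Y → X),
        AmenableRel.IsClassBijectiveExtension π S ν R μ →
        ∀ f : Y → 𝕜, AmenableRel.MemLlog f ν →
          AEMeasurable (AmenableRel.maximal (AmenableRel.lift π S F) f) ν ∧
          eLpNorm (AmenableRel.maximal (AmenableRel.lift π S F) f) 1 ν ≤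
            C * AmenableRel.llogNorm f ν) := by
  have hIm := AmenableRel.measurableSet_of_eq_posInts_or hI
  have hIn := AmenableRel.exists_nat_le_of_eq_posInts_or hI
  obtain ⟨K, hK⟩ := AmenableRel.exists_weakType_lift.{u, v} hI hF (h.imp_right And.right)
  refine ⟨fun p hp => ?_, 1 + 36 * K, by positivity, fun Y _ _ ν _ S π hext f hf => ?_⟩
  · by_cases hp' : p = ∞
    · refine ⟨1, one_pos, fun Y _ _ ν _ S π hext f hf => ?_⟩
      have hG := AmenableRel.isAEFamily_lift hF hext
      refine ⟨AmenableRel.aemeasurable_maximal hext.discreteMP hG hIm hIn hf.aestronglyMeasurable,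
        ?_⟩
      rw [hp', ENNReal.coe_one, one_mul]
      exact AmenableRel.eLpNorm_top_maximal_le hext.discreteMP hG.subset_cls f
    · have hp1 : 0 < p.toReal - 1 := by
        rw [sub_pos, ← ENNReal.toReal_one]
        exact (ENNReal.toReal_lt_toReal ENNReal.one_ne_top hp').2 hp
      set C : ℝ≥0∞ := (ENNReal.ofReal p.toReal * (2 * K * (ENNReal.ofReal (p.toReal - 1))⁻¹ *
        ENNReal.ofReal (2 ^ (p.toReal - 1)))) ^ (1 / p.toReal) with hCdef
      have hC : C ≠ ∞ := by
        refine ENNReal.rpow_ne_top_of_nonneg (by positivity) ?_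
        refine ENNReal.mul_ne_top ENNReal.ofReal_ne_top (ENNReal.mul_ne_top (ENNReal.mul_ne_top
          (ENNReal.mul_ne_top ENNReal.ofNat_ne_top ENNReal.coe_ne_top) ?_) ENNReal.ofReal_ne_top)
        exact ENNReal.inv_ne_top.2 (ENNReal.ofReal_pos.2 hp1).ne'
      -- Adding 1 makes the constant positive even when `K = 0`.
      refine ⟨C.toNNReal + 1, by positivity, fun Y _ _ ν _ S π hext f hf => ?_⟩
      have hG := AmenableRel.isAEFamily_lift hF hext
      refine ⟨AmenableRel.aemeasurable_maximal hext.discreteMP hG hIm hIn hf.aestronglyMeasurable,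
        (AmenableRel.eLpNorm_maximal_le hext.discreteMP hG hIm hIn (hK Y ν S π hext) hp hp'
          hf).trans ?_⟩
      rw [← hCdef, ENNReal.coe_add, ENNReal.coe_toNNReal hC]
      gcongr
      exact le_self_add
  · have hG := AmenableRel.isAEFamily_lift hF hext
    refine ⟨AmenableRel.aemeasurable_maximal hext.discreteMP hG hIm hIn hf.1, ?_⟩
    have := AmenableRel.eLpNorm_one_maximal_le hext.discreteMP hG hIm hIn (hK Y ν S π hext) hf.1
    simpa using this
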